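/- \textbf{Setting.} Let $X$ be a connected, paracompact (Hausdorff) $C^2$ manifold modeled on a real Banach space $E$, endowed with a Finsler structure in the sense of Palais: a continuous function $TX\to[0,\infty)$, $(x,v)\mapsto\|v\|_x$, such that (i) read in any chart, $\|\cdot\|_x$ is a norm on $E$ equivalent to the given norm, and (ii) for every $x_0\in X$ and $k>1$ there is a chart $\varphi:W\to E$ at $x_0$ with $k^{-1}\|v_{x_0}(w)\|_{x_0}\le\|v_x(w)\|_x\le k\|v_{x_0}(w)\|_{x_0}$ for all $x\in W$, $w\in E$, where $v_x(w)=d\varphi^{-1}(\varphi(x))w$. Let $d_X(x,x')$ be the infimum of the lengths $\int\|\dot\alpha(t)\|\,dt$ of the $C^1$ paths $\alpha$ joining $x$ to $x'$, and suppose that $(X,d_X)$ is complete. Write $B_r(x_0)=\{x\in X: d_X(x_0,x)<r\}$. Let $F$ be a real Banach space and let $f:X\to F$ be a $C^1$ map whose derivative is locally Lipschitz (in charts), such that $df(x):T_xX\to F$ is onto for every $x\in X$. Suppose that $f$ has uniformly split kernels: there is a constant $C>0$ such that for every $x\in X$ there is a continuous linear projection $P_x$ of $T_xX$ with $\ker P_x=\ker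 df(x)$ and $\|P_x\|_x\le C$. Put $$\operatorname{Sur} df(x)=\inf\{\|df(x)^*v^*\|_x : v^*\in F^*,\ \|v^*\|=1\},$$ where $\|\cdot\|_x$ on $(T_xX)^*$ is the dual norm. A locally Lipschitz right inverse of $df$ is a family $s$ of continuous linear maps $s(x):F\to T_xX$ with $df(x)s(x)=\mathrm{id}_F$ for all $x\in X$, such that in every chart $\varphi$ of $X$ the map $p\mapsto d\varphi(\varphi^{-1}(p))\,s(\varphi^{-1}(p))$ is locally Lipschitz; $\|s(x)\|$ denotes the operator norm with respect to $\|\cdot\|_x$. (If $F=\{0\}$, then $\operatorname{Sur} df(x)$ is read as $0$, and $\|s(x)\|^{-1}$ as $0$.) \textbf{Theorem (global Graves theorem).} There are a constant $c>0$ and a locally Lipschitz right inverse $s$ of $df$ such that $$\operatorname{Sur} df(x)\le c\,\|s(x)\|^{-1}\qquad\text{for all }x\in X. \tag{1}$$ Moreover, let $c>0$ be any constant for which (1) holds with some locally Lipschitz right inverse $s$ of $df$, let $x_0\in X$, and set $$\eta(\rho)=\frac1c\inf_{d_X(x_0,x)\le\rho}\operatorname{Sur} df(x)\quad(\rho\ge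 0),\qquad \varrho(r)=\int_0^r\eta(\rho)\,d\rho .$$ If $r>0$ and $\varrho=\varrho(r)>0$, then $$B_\varrho(f(x_0))\subset f(B_r(x_0)),$$ where $B_\varrho(f(x_0))$ is the open ball of $F$. -/

import Mathlib

open Set Filter Topology
open scoped Manifold ENNReal ContDiff

noncomputable section

/-! ### Finsler structures (in the sense of Palais) on `C²` Banach manifolds -/

/-- For a chart `φ` of `X` and a point `p` of its target, `chartVec φ p w` is the tangent vector
of `X` at the point `φ⁻¹ p` that is represented by `w ∈ E` in the chart `φ`,
that is, `d(φ⁻¹)(p) w`. -/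
def chartVec {E : Type*} [NormedAddCommGroup E] [NormedSpace ℝ E]
    {X : Type*} [TopologicalSpace X] [ChartedSpace E X]
    (φ : OpenPartialHomeomorph X E) (p w : E) : TangentSpace 𝓘(ℝ, E) (φ.symm p) :=
  mfderiv 𝓘(ℝ, E) 𝓘(ℝ, E) φ.symm p w

/-- A Finsler structure on the tangent bundle of a `C²` manifold `X` modeled on `E`:
a continuous function on `TX` which is an admissible norm on every tangent space and which, for
every `k > 1`, is `k`-almost constant in a suitable chart around any given point. -/
structure FinslerStructure (E : Type*) [NormedAddCommGroup E] [NormedSpace ℝ E]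
    (X : Type*) [TopologicalSpace X] [ChartedSpace E X] [IsManifold 𝓘(ℝ, E) 2 X] where
  /-- The norm `‖·‖ₓ` on the tangent space at `x`. -/
  nrm : (x : X) → Seminorm ℝ (TangentSpace 𝓘(ℝ, E) x)
  /-- `(x, v) ↦ ‖v‖ₓ` is continuous on the tangent bundle. -/
  continuous_nrm : Continuous fun v : TangentBundle 𝓘(ℝ, E) X => nrm v.proj v.snd
  /-- Read in any chart, `‖·‖ₓ` is a norm on `E` equivalent to the given one. -/
  admissible : ∀ φ ∈ IsManifold.maximalAtlas 𝓘(ℝ, E) 2 X, ∀ p ∈ φ.target,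
    ∃ C : ℝ, 0 < C ∧ ∀ w : E,
      C⁻¹ * ‖w‖ ≤ nrm (φ.symm p) (chartVec φ p w) ∧
      nrm (φ.symm p) (chartVec φ p w) ≤ C * ‖w‖
  /-- For all `x₀` and `k > 1` some chart `φ` at `x₀` satisfies
  `k⁻¹ ‖v_{x₀}(w)‖_{x₀} ≤ ‖v_x(w)‖_x ≤ k ‖v_{x₀}(w)‖_{x₀}` for all `x = φ⁻¹ p` in its domain. -/
  almost_constant : ∀ (x₀ : X) (k : ℝ), 1 < k →
    ∃ φ ∈ IsManifold.maximalAtlas 𝓘(ℝ, E) 2 X, x₀ ∈ φ.source ∧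
      ∀ p ∈ φ.target, ∀ w : E,
        k⁻¹ * nrm (φ.symm (φ x₀)) (chartVec φ (φ x₀) w)
            ≤ nrm (φ.symm p) (chartVec φ p w) ∧
        nrm (φ.symm p) (chartVec φ p w)
            ≤ k * nrm (φ.symm (φ x₀)) (chartVec φ (φ x₀) w)

namespace FinslerStructure

variable {E : Type*} [NormedAddCommGroup E] [NormedSpace ℝ E]
  {X : Type*} [TopologicalSpace X] [ChartedSpace E X] [IsManifold 𝓘(ℝ, E) 2 X]

/-- The infimum of the lengths `∫ ‖γ'(t)‖ dt` of the `C¹` paths from `x` to `y`, as an element of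
`[0, ∞]`. (Mathlib's `riemannianEDist` is this infimum for an arbitrary family of norms on the
tangent spaces; no inner product is involved.) -/
def finslerEDist (N : FinslerStructure E X) (x y : X) : ℝ≥0∞ :=
  letI : ∀ z : X, ENorm (TangentSpace 𝓘(ℝ, E) z) := fun z => ⟨fun v => ENNReal.ofReal (N.nrm z v)⟩
  Manifold.riemannianEDist 𝓘(ℝ, E) x y

/-- The Finsler metric `d_X` (it is finite when `X` is connected). -/
def finslerDist (N : FinslerStructure E X) (x y : X) : ℝ :=
  (N.finslerEDist x y).toReal

/-- Completeness of the Finsler metric: every Cauchy sequence converges. -/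
def IsComplete (N : FinslerStructure E X) : Prop :=
  ∀ u : ℕ → X,
    (∀ ε : ℝ, 0 < ε → ∃ n₀ : ℕ, ∀ m ≥ n₀, ∀ n ≥ n₀, N.finslerDist (u m) (u n) < ε) →
    ∃ x : X, Tendsto (fun n => N.finslerDist (u n) x) atTop (𝓝 0)

variable {F : Type*} [NormedAddCommGroup F] [NormedSpace ℝ F]

/-- The dual norm of a continuous linear form on the tangent space `(T_xX, ‖·‖ₓ)`. -/
def dualNorm (N : FinslerStructure E X) (x : X) (l : TangentSpace 𝓘(ℝ, E) x →L[ℝ] ℝ) : ℝ :=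
  sSup {a : ℝ | ∃ v : TangentSpace 𝓘(ℝ, E) x, N.nrm x v ≤ 1 ∧ a = |l v|}

/-- The operator norm of a continuous linear map from `F` to `(T_xX, ‖·‖ₓ)`. -/
def opNorm (N : FinslerStructure E X) (x : X) (T : F →L[ℝ] TangentSpace 𝓘(ℝ, E) x) : ℝ :=
  sSup {a : ℝ | ∃ y : F, ‖y‖ ≤ 1 ∧ a = N.nrm x (T y)}

end FinslerStructure

/-! ### Maps from a Finsler manifold to a Banach space -/

section Maps

variable {E : Type*} [NormedAddCommGroup E] [NormedSpace ℝ E]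
  {X : Type*} [TopologicalSpace X] [ChartedSpace E X]
  {F : Type*} [NormedAddCommGroup F] [NormedSpace ℝ F]

/-- The derivative `df(x) : T_xX → F`, where the tangent spaces of `F` are identified with `F`. -/
def dAt (f : X → F) (x : X) : TangentSpace 𝓘(ℝ, E) x →L[ℝ] F :=
  mfderiv 𝓘(ℝ, E) 𝓘(ℝ, F) f x

/-- The surjectivity indicator `Sur df(x) = inf {‖df(x)* v*‖ : v* ∈ F*, ‖v*‖ = 1}`. -/
def surInd [IsManifold 𝓘(ℝ, E) 2 X] (N : FinslerStructure E X) (f : X → F) (x : X) : ℝ :=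
  sInf {a : ℝ | ∃ l : F →L[ℝ] ℝ, ‖l‖ = 1 ∧ a = N.dualNorm x (l.comp (dAt (E := E) f x))}

/-- `f` is `C¹` and its derivative, read in any chart of the `C²` manifold `X`, is locally
Lipschitz. -/
def HasLocallyLipschitzDeriv (E : Type*) [NormedAddCommGroup E] [NormedSpace ℝ E]
    {X : Type*} [TopologicalSpace X] [ChartedSpace E X] (f : X → F) : Prop :=
  ContMDiff 𝓘(ℝ, E) 𝓘(ℝ, F) 1 f ∧
    ∀ φ ∈ IsManifold.maximalAtlas 𝓘(ℝ, E) 2 X,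
      LocallyLipschitzOn φ.target (fun p : E => fderiv ℝ (fun q : E => f (φ.symm q)) p)

/-- `f` is a submersion: `df(x)` is onto for every `x`. -/
def IsSubmersionMap (E : Type*) [NormedAddCommGroup E] [NormedSpace ℝ E]
    {X : Type*} [TopologicalSpace X] [ChartedSpace E X] (f : X → F) : Prop :=
  ∀ x : X, Function.Surjective (dAt (E := E) f x)

/-- `f` has uniformly split kernels: for some `c > 0`, every `T_xX` has a continuous linear
projection `P` with `ker P = ker df(x)` and `‖P‖ₓ ≤ c`. -/
def HasUniformlySplitKernels [IsManifold 𝓘(ℝ, E) 2 X] (N : FinslerStructure E X)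
    (f : X → F) : Prop :=
  ∃ c : ℝ, 0 < c ∧ ∀ x : X, ∃ P : TangentSpace 𝓘(ℝ, E) x →L[ℝ] TangentSpace 𝓘(ℝ, E) x,
    (∀ v, P (P v) = P v) ∧ (∀ v, P v = 0 ↔ dAt (E := E) f x v = 0) ∧
    ∀ v, N.nrm x (P v) ≤ c * N.nrm x v

/-- The representation in the chart `φ` of a family `s` of linear maps `s(x) : F → T_xX`:
the map `p ↦ dφ(φ⁻¹ p) ∘ s(φ⁻¹ p)`. -/
def chartRep (s : (x : X) → F →L[ℝ] TangentSpace 𝓘(ℝ, E) x)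
    (φ : OpenPartialHomeomorph X E) (p : E) : F →L[ℝ] E :=
  ContinuousLinearMap.comp
    (mfderiv 𝓘(ℝ, E) 𝓘(ℝ, E) φ (φ.symm p) : TangentSpace 𝓘(ℝ, E) (φ.symm p) →L[ℝ] E)
    (s (φ.symm p))

/-- `s` is a locally Lipschitz right inverse of `df`. -/
def IsLocLipRightInverse (f : X → F)
    (s : (x : X) → F →L[ℝ] TangentSpace 𝓘(ℝ, E) x) : Prop :=
  (∀ φ ∈ IsManifold.maximalAtlas 𝓘(ℝ, E) 2 X, LocallyLipschitzOn φ.target (chartRep s φ)) ∧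
    ∀ (x : X) (y : F), dAt (E := E) f x (s x y) = y

/-- `s` is a locally Lipschitz right inverse of `df` and `c > 0` is a constant such that
`Sur df(x) ≤ c ‖s(x)‖⁻¹` for every `x`. -/
def IsRabierPair [IsManifold 𝓘(ℝ, E) 2 X] (N : FinslerStructure E X) (f : X → F) (c : ℝ)
    (s : (x : X) → F →L[ℝ] TangentSpace 𝓘(ℝ, E) x) : Prop :=
  0 < c ∧ IsLocLipRightInverse f s ∧ ∀ x : X, surInd N f x ≤ c * (N.opNorm x (s x))⁻¹

/-- `η(ρ) = (1/c) inf {Sur df(x) : d_X(x₀, x) ≤ ρ}`. -/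
def etaFun [IsManifold 𝓘(ℝ, E) 2 X] (N : FinslerStructure E X) (f : X → F) (c : ℝ) (x₀ : X)
    (ρ : ℝ) : ℝ :=
  (1 / c) * sInf {a : ℝ | ∃ x : X, N.finslerDist x₀ x ≤ ρ ∧ a = surInd N f x}

/-- `ϱ(r) = ∫₀^r η(ρ) dρ`. -/
def rhoFun [IsManifold 𝓘(ℝ, E) 2 X] (N : FinslerStructure E X) (f : X → F) (c : ℝ) (x₀ : X)
    (r : ℝ) : ℝ :=
  ∫ ρ in (0 : ℝ)..r, etaFun N f c x₀ ρ

end Maps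

end

/-!
# The global Graves theorem on Finsler manifolds

*Metric.* A short path cannot leave a small neighborhood of its starting point, because its length
controls how far it gets in a chart that distorts the Finsler norms by bounded factors; conversely
segments in such a chart are short. Hence the Finsler distance induces the topology of the manifold
(`FinslerStructure.metricSpace`), and it is finite by connectedness.

*Existence of a right inverse.* Let `P` be the projection with kernel `ker df(x)`. It factors as
`P = T ∘ df(x)` with a right inverse `T` of `df(x)`. By Hahn–Banach, for every `y` there is a linear
form `l` with `l y = ‖T y‖` and `|l z| ≤ ‖T z‖` for all `z`, so that
`|l (df(x) v)| ≤ ‖P v‖ ≤ C ‖v‖`; therefore `Sur df(x) * ‖l‖ ≤ C`, and `Sur df(x) * ‖T y‖ ≤ C ‖y‖`.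
In a chart, `T ∘ (df ∘ T)⁻¹` extends `T` to a locally Lipschitz right inverse near `x` that
satisfies the same kind of estimate with a larger constant (`exists_local_rightInverse`). The right
inverses that satisfy the estimate form a convex set, so that a locally Lipschitz partition of
unity, made of truncated Finsler distances to closed sets, glues the local families
(`FinslerStructure.exists_section_of_local`).

*Covering.* Instead of integrating the field `x ↦ s(x) (y - f x)`, one descends along it in small
steps: moving from `x` in this direction decreases `g = ‖f - y‖`, per unit of distance, at least
at a rate as close to `Sur df(x) / c` as desired (`FinslerStructure.eventually_exists_descent`). A maximality
argument in the spirit of Caristi's theorem, for pairs of a point and a bound `l` for the distance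
spent to reach it, with the condition `g(x) + θ ϱ(l) ≤ g(x₀)` for a factor `θ < 1` close to `1`,
then produces a zero of `g` before the distance `r` is spent (`exists_eq_zero_of_local_descent`).
-/

/-! ### Tangent vectors in charts -/

section Charts

variable {E : Type*} [NormedAddCommGroup E] [NormedSpace ℝ E]
  {X : Type*} [TopologicalSpace X] [ChartedSpace E X] {φ : OpenPartialHomeomorph X E}

theorem mdifferentiable_of_mem_maximalAtlas (hφ : φ ∈ IsManifold.maximalAtlas 𝓘(ℝ, E) 2 X) :
    φ.MDifferentiable 𝓘(ℝ, E) 𝓘(ℝ, E) :=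
  ⟨(contMDiffOn_of_mem_maximalAtlas hφ).mdifferentiableOn two_ne_zero,
    (contMDiffOn_symm_of_mem_maximalAtlas hφ).mdifferentiableOn two_ne_zero⟩

theorem chartVec_mfderiv (hφ : φ ∈ IsManifold.maximalAtlas 𝓘(ℝ, E) 2 X) {p : E}
    (hp : p ∈ φ.target) (v : TangentSpace 𝓘(ℝ, E) (φ.symm p)) :
    chartVec φ p (mfderiv 𝓘(ℝ, E) 𝓘(ℝ, E) φ (φ.symm p) v) = v := by
  have h := (mdifferentiable_of_mem_maximalAtlas hφ).symm_comp_deriv (φ.map_target hp)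
  rw [φ.right_inv hp] at h
  exact congr($h v)

theorem mfderiv_chartVec (hφ : φ ∈ IsManifold.maximalAtlas 𝓘(ℝ, E) 2 X) {p : E}
    (hp : p ∈ φ.target) (w : E) :
    mfderiv 𝓘(ℝ, E) 𝓘(ℝ, E) φ (φ.symm p) (chartVec φ p w) = w :=
  congr($((mdifferentiable_of_mem_maximalAtlas hφ).comp_symm_deriv hp) w)

end Charts

/-! ### The topology of the Finsler distance -/

namespace FinslerStructure

variable {E : Type*} [NormedAddCommGroup E] [NormedSpace ℝ E]
  {X : Type*} [TopologicalSpace X] [ChartedSpace E X] [IsManifold 𝓘(ℝ, E) 2 X]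
  {φ : OpenPartialHomeomorph X E}

/-- The norms of a Finsler structure as extended norms on the tangent spaces; these are the ones
whose path lengths define `finslerEDist`. -/
@[reducible] noncomputable def tangentENorm (N : FinslerStructure E X) (z : X) :
    ENorm (TangentSpace 𝓘(ℝ, E) z) := ⟨fun v => ENNReal.ofReal (N.nrm z v)⟩

theorem tangentENormSMulClass (N : FinslerStructure E X) (z : X) :
    letI := N.tangentENorm
    ENormSMulClass ℝ (TangentSpace 𝓘(ℝ, E) z) := by
  let := N.tangentENorm
  refine ⟨fun r v => ?_⟩
  change ENNReal.ofReal (N.nrm z (r • v)) = _ * ENNReal.ofReal (N.nrm z v)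
  rw [map_smul_eq_mul, ENNReal.ofReal_mul (norm_nonneg _), ofReal_norm]

theorem finslerEDist_self (N : FinslerStructure E X) (x : X) : N.finslerEDist x x = 0 := by
  let := N.tangentENorm
  have := N.tangentENormSMulClass
  exact Manifold.riemannianEDist_self

theorem finslerEDist_comm (N : FinslerStructure E X) (x y : X) :
    N.finslerEDist x y = N.finslerEDist y x := by
  let := N.tangentENorm
  have := N.tangentENormSMulClass
  exact Manifold.riemannianEDist_comm

theorem finslerEDist_triangle (N : FinslerStructure E X) (x y z : X) :
    N.finslerEDist x z ≤ N.finslerEDist x y + N.finslerEDist y z := by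
  let := N.tangentENorm
  have := N.tangentENormSMulClass
  exact Manifold.riemannianEDist_triangle

/-- The distance of two points of a chart is at most the length of the path that is a segment in
the chart. -/
theorem finslerEDist_symm_le (N : FinslerStructure E X)
    (hφ : φ ∈ IsManifold.maximalAtlas 𝓘(ℝ, E) 2 X) {p q : E} {A : ℝ}
    (hseg : segment ℝ p q ⊆ φ.target)
    (hA : ∀ z ∈ segment ℝ p q, N.nrm (φ.symm z) (chartVec φ z (q - p)) ≤ A) :
    N.finslerEDist (φ.symm p) (φ.symm q) ≤ ENNReal.ofReal A := by
  let := N.tangentENorm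
  have := N.tangentENormSMulClass
  let η := ContinuousAffineMap.lineMap (R := ℝ) p q
  have hη : ∀ t ∈ Icc (0 : ℝ) 1, η t ∈ segment ℝ p q := fun t ht => by
    rw [segment_eq_image_lineMap]
    exact ⟨t, ht, rfl⟩
  have η_smooth : ContMDiffOn 𝓘(ℝ, ℝ) 𝓘(ℝ, E) 1 η (Icc 0 1) :=
    (contMDiff_iff_contDiff.2 (ContinuousAffineMap.contDiff _)).contMDiffOn
  have γ_smooth : ContMDiffOn 𝓘(ℝ, ℝ) 𝓘(ℝ, E) 1 (φ.symm ∘ η) (Icc 0 1) :=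
    ((contMDiffOn_symm_of_mem_maximalAtlas hφ).of_le one_le_two).comp η_smooth
      fun t ht => hseg (hη t ht)
  have h1 : N.finslerEDist (φ.symm p) (φ.symm q)
      ≤ Manifold.pathELength 𝓘(ℝ, E) (φ.symm ∘ η) 0 1 :=
    Manifold.riemannianEDist_le_pathELength γ_smooth
      (by simp [η, ContinuousAffineMap.coe_lineMap_eq])
      (by simp [η, ContinuousAffineMap.coe_lineMap_eq]) zero_le_one
  refine h1.trans ?_
  have h2 : ENNReal.ofReal A = ∫⁻ _ in Icc (0 : ℝ) 1, ENNReal.ofReal A := by simp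
  rw [Manifold.pathELength_eq_lintegral_mfderiv_Ioo, h2,
    ← MeasureTheory.restrict_Ioo_eq_restrict_Icc]
  refine MeasureTheory.setLIntegral_mono' measurableSet_Ioo fun t ht => ?_
  have htz := hη t ⟨ht.1.le, ht.2.le⟩
  have hd : mfderiv 𝓘(ℝ, ℝ) 𝓘(ℝ, E) (φ.symm ∘ η) t 1 = chartVec φ (η t) (q - p) := by
    have hη' : MDifferentiableAt 𝓘(ℝ, ℝ) 𝓘(ℝ, E) η t :=
      mdifferentiableAt_iff_differentiableAt.2 (ContinuousAffineMap.differentiableAt _)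
    have := mfderiv_comp t
      ((mdifferentiable_of_mem_maximalAtlas hφ).mdifferentiableAt_symm (hseg htz)) hη'
    rw [this, mfderiv_eq_fderiv]
    change mfderiv 𝓘(ℝ, E) 𝓘(ℝ, E) φ.symm (η t) (fderiv ℝ η t 1) = _
    have : fderiv ℝ η t 1 = q - p := by simp [η]
    rw [this]
    rfl
  change ENNReal.ofReal (N.nrm (φ.symm (η t)) (mfderiv 𝓘(ℝ, ℝ) 𝓘(ℝ, E) (φ.symm ∘ η) t 1)) ≤ _
  rw [hd]
  exact ENNReal.ofReal_le_ofReal (hA _ htz)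

/-- Around every point some chart distorts the Finsler norms by bounded factors only. -/
theorem exists_chart_norm_equiv (N : FinslerStructure E X) (x₀ : X) :
    ∃ φ ∈ IsManifold.maximalAtlas 𝓘(ℝ, E) 2 X, x₀ ∈ φ.source ∧ ∃ C : ℝ, 0 < C ∧
      ∀ p ∈ φ.target, ∀ w : E, ‖w‖ ≤ C * N.nrm (φ.symm p) (chartVec φ p w) ∧
        N.nrm (φ.symm p) (chartVec φ p w) ≤ C * ‖w‖ := by
  obtain ⟨φ, hφ, hx, hk⟩ := N.almost_constant x₀ 2 one_lt_two
  obtain ⟨C, hC, hadm⟩ := N.admissible φ hφ (φ x₀) (φ.map_source hx)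
  refine ⟨φ, hφ, hx, C * 2, by positivity, fun p hp w => ⟨?_, ?_⟩⟩
  · have h1 := (hadm w).1
    have h2 := (hk p hp w).1
    rw [inv_mul_le_iff₀ (by positivity)] at h1 h2
    calc ‖w‖ ≤ C * N.nrm (φ.symm (φ x₀)) (chartVec φ (φ x₀) w) := h1
      _ ≤ C * (2 * N.nrm (φ.symm p) (chartVec φ p w)) := by gcongr
      _ = _ := by ring
  · calc N.nrm (φ.symm p) (chartVec φ p w)
        ≤ 2 * N.nrm (φ.symm (φ x₀)) (chartVec φ (φ x₀) w) := (hk p hp w).2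
      _ ≤ 2 * (C * ‖w‖) := by gcongr; exact (hadm w).2
      _ = _ := by ring

/-- The Finsler distance is locally at most a multiple of the distance in a suitable chart. -/
theorem exists_chart_finslerEDist_le (N : FinslerStructure E X) (x₀ : X) :
    ∃ φ ∈ IsManifold.maximalAtlas 𝓘(ℝ, E) 2 X, x₀ ∈ φ.source ∧ ∃ C : ℝ, 0 < C ∧
      ∃ δ : ℝ, 0 < δ ∧ Metric.ball (φ x₀) δ ⊆ φ.target ∧
      ∀ p ∈ Metric.ball (φ x₀) δ, ∀ q ∈ Metric.ball (φ x₀) δ,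
        N.finslerEDist (φ.symm p) (φ.symm q) ≤ ENNReal.ofReal (C * ‖q - p‖) := by
  obtain ⟨φ, hφ, hx, C, hC, hb⟩ := N.exists_chart_norm_equiv x₀
  obtain ⟨δ, hδ, hball⟩ := Metric.isOpen_iff.1 φ.open_target _ (φ.map_source hx)
  refine ⟨φ, hφ, hx, C, hC, δ, hδ, hball, fun p hp q hq => ?_⟩
  have hseg := ((convex_ball (φ x₀) δ).segment_subset hp hq).trans hball
  exact N.finslerEDist_symm_le hφ hseg fun z hz => (hb z (hseg hz) _).2

/-- Points that are close for the topology of the manifold are close for the Finsler distance: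
they are joined by a short segment in a chart. -/
theorem eventually_finslerEDist_lt (N : FinslerStructure E X) (x : X) {c : ℝ≥0∞} (hc : 0 < c) :
    ∀ᶠ y in 𝓝 x, N.finslerEDist x y < c := by
  obtain ⟨φ, hφ, hx, C, hC, δ, hδ, hball, h⟩ := N.exists_chart_finslerEDist_le x
  have h1 : Tendsto (fun y => ENNReal.ofReal (C * ‖φ y - φ x‖)) (𝓝 x) (𝓝 0) := by
    have h0 : ContinuousAt φ x := φ.continuousAt hx
    have : Tendsto (fun y => C * ‖φ y - φ x‖) (𝓝 x) (𝓝 (C * ‖φ x - φ x‖)) :=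
      ((h0.sub continuousAt_const).norm).const_mul C
    simpa using ENNReal.tendsto_ofReal this
  filter_upwards [h1.eventually (gt_mem_nhds hc), φ.open_source.mem_nhds hx,
    (φ.continuousAt hx).preimage_mem_nhds (Metric.ball_mem_nhds _ hδ)] with y hy hys hyb
  have := h (φ x) (Metric.mem_ball_self hδ) (φ y) hyb
  rw [φ.left_inv hx, φ.left_inv hys] at this
  exact this.trans_lt hy

theorem eq_zero_of_nrm_eq_zero (N : FinslerStructure E X) {x : X} {v : TangentSpace 𝓘(ℝ, E) x}
    (hv : N.nrm x v = 0) : v = 0 := by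
  obtain ⟨φ, hφ, hx, C, hC, hb⟩ := N.exists_chart_norm_equiv x
  obtain ⟨p, hp, rfl⟩ : ∃ p ∈ φ.target, φ.symm p = x := ⟨φ x, φ.map_source hx, φ.left_inv hx⟩
  have h := (hb p hp (mfderiv 𝓘(ℝ, E) 𝓘(ℝ, E) φ (φ.symm p) v)).1
  rw [chartVec_mfderiv hφ hp, hv, mul_zero] at h
  rw [← chartVec_mfderiv hφ hp v, norm_le_zero_iff.1 h]
  exact map_zero (mfderiv 𝓘(ℝ, E) 𝓘(ℝ, E) φ.symm p)

theorem norm_mfderiv_le {N : FinslerStructure E X}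
    (hφ : φ ∈ IsManifold.maximalAtlas 𝓘(ℝ, E) 2 X) {C : ℝ}
    (hC : ∀ p ∈ φ.target, ∀ w : E, ‖w‖ ≤ C * N.nrm (φ.symm p) (chartVec φ p w)) {x : X}
    (hx : x ∈ φ.source) (v : TangentSpace 𝓘(ℝ, E) x) :
    norm (E := E) (mfderiv 𝓘(ℝ, E) 𝓘(ℝ, E) φ x v) ≤ C * N.nrm x v := by
  obtain ⟨p, hp, rfl⟩ : ∃ p ∈ φ.target, φ.symm p = x := ⟨φ x, φ.map_source hx, φ.left_inv hx⟩
  have := hC p hp (mfderiv 𝓘(ℝ, E) 𝓘(ℝ, E) φ (φ.symm p) v)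
  rwa [chartVec_mfderiv hφ hp] at this

open scoped NNReal in
/-- A path that leaves a neighborhood of its starting point `x` has length at least some positive
constant: as long as it stays in a closed set inside a chart that distorts the norms by bounded
factors only, its length bounds how far it gets in that chart. -/
theorem exists_finslerEDist_lt_subset (N : FinslerStructure E X) [RegularSpace X] {x : X}
    {s : Set X} (hs : s ∈ 𝓝 x) : ∃ c : ℝ≥0∞, 0 < c ∧ {y | N.finslerEDist x y < c} ⊆ s := by
  let := N.tangentENorm
  have := N.tangentENormSMulClass
  obtain ⟨φ, hφ, hx, C', hC', hb⟩ := N.exists_chart_norm_equiv x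
  obtain ⟨u, u_mem, u_closed, hu⟩ :=
    exists_mem_nhds_isClosed_subset (Filter.inter_mem hs (φ.open_source.mem_nhds hx))
  simp only [subset_inter_iff] at hu
  obtain ⟨us, uc⟩ := hu
  obtain ⟨v, ⟨v_mem, v_open⟩, hv⟩ := (nhds_basis_opens' x).mem_iff.1 u_mem
  have hsymm : φ.symm ⁻¹' v ∈ 𝓝 (φ x) := by
    refine (φ.continuousAt_symm (φ.map_source hx)).preimage_mem_nhds ?_
    rwa [φ.left_inv hx]
  obtain ⟨r', r_pos', hr⟩ := Metric.mem_nhds_iff.1 hsymm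
  lift C' to ℝ≥0 using hC'.le with C
  lift r' to ℝ≥0 using r_pos'.le with r
  have C_pos : 0 < C := by exact_mod_cast hC'
  have r_pos : 0 < r := by exact_mod_cast r_pos'
  refine ⟨((r / C : ℝ≥0) : ℝ≥0∞), by positivity, fun y hy => ?_⟩
  rcases Manifold.exists_lt_locally_constant_of_riemannianEDist_lt hy zero_lt_one
    with ⟨γ, hγx, hγy, γ_smooth, hγ, -⟩
  let A := γ ⁻¹' u
  have zero_mem : 0 ∈ A := by simpa [hγx, A] using mem_of_mem_nhds u_mem
  have A_closed : IsClosed (A ∩ Icc 0 1) :=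
    (u_closed.preimage γ_smooth.continuous).inter isClosed_Icc
  suffices Icc 0 1 ⊆ A by
    apply us
    have : 1 ∈ A := this ⟨zero_le_one, le_rfl⟩
    simpa [A, hγy, us] using this
  -- It suffices that the path, if it is in `u` up to the time `t₁`, is in the open set `v` then.
  apply A_closed.Icc_subset_of_forall_mem_nhdsGT_of_Icc_subset zero_mem
  rintro t₁ ⟨ht₁0, ht₁1⟩ t₁_mem
  suffices γ t₁ ∈ v from
    γ_smooth.continuous.continuousWithinAt <| mem_of_superset (v_open.mem_nhds this) hv
  let γ' := φ ∘ γ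
  have hC : ContMDiffOn 𝓘(ℝ, ℝ) 𝓘(ℝ, E) 1 γ' (Icc 0 t₁) :=
    ((contMDiffOn_of_mem_maximalAtlas hφ).of_le one_le_two).comp
      γ_smooth.contMDiffOn fun t' ht' => uc <| t₁_mem ht'
  have hnorm : ‖γ' t₁ - γ' 0‖ₑ < r := by
    rcases ht₁0.eq_or_lt with rfl | h't'
    · simp [r_pos]
    calc
      ‖γ' t₁ - γ' 0‖ₑ
    _ ≤ ∫⁻ t' in Icc 0 t₁, ‖derivWithin γ' (Icc 0 t₁) t'‖ₑ := by
      apply enorm_sub_le_lintegral_derivWithin_Icc_of_contDiffOn_Icc _ ht₁0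
      rwa [← contMDiffOn_iff_contDiffOn]
    _ ≤ ∫⁻ t' in Icc 0 t₁, C * ‖mfderivWithin 𝓘(ℝ, ℝ) 𝓘(ℝ, E) γ (Icc 0 t₁) t' 1‖ₑ := by
      apply MeasureTheory.setLIntegral_mono' measurableSet_Icc (fun t' ht' ↦ ?_)
      have hsrc : γ t' ∈ φ.source := uc (t₁_mem ht')
      have h1 : mfderivWithin 𝓘(ℝ, ℝ) 𝓘(ℝ, E) γ' (Icc 0 t₁) t' =
          (mfderiv 𝓘(ℝ, E) 𝓘(ℝ, E) φ (γ t')) ∘L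
            (mfderivWithin 𝓘(ℝ, ℝ) 𝓘(ℝ, E) γ (Icc 0 t₁) t') := by
        apply mfderiv_comp_mfderivWithin
        · exact (mdifferentiable_of_mem_maximalAtlas hφ).mdifferentiableAt hsrc
        · exact (γ_smooth.mdifferentiable one_ne_zero).mdifferentiableOn _ ht'
        · rw [uniqueMDiffWithinAt_iff_uniqueDiffWithinAt]
          exact uniqueDiffOn_Icc h't' _ ht'
      have h2 : derivWithin γ' (Icc 0 t₁) t' = mfderiv 𝓘(ℝ, E) 𝓘(ℝ, E) φ (γ t')
          (mfderivWithin 𝓘(ℝ, ℝ) 𝓘(ℝ, E) γ (Icc 0 t₁) t' 1) := by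
        rw [← fderivWithin_derivWithin, ← mfderivWithin_eq_fderivWithin]
        exact congr($h1 1)
      have h3 := norm_mfderiv_le hφ (fun p hp w => (hb p hp w).1) hsrc
        (mfderivWithin 𝓘(ℝ, ℝ) 𝓘(ℝ, E) γ (Icc 0 t₁) t' 1)
      rw [← h2] at h3
      rw [← ofReal_norm]
      refine (ENNReal.ofReal_le_ofReal h3).trans_eq ?_
      rw [ENNReal.ofReal_mul NNReal.zero_le_coe, ENNReal.ofReal_coe_nnreal]
      rfl
    _ = C * Manifold.pathELength 𝓘(ℝ, E) γ 0 t₁ := by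
      rw [MeasureTheory.lintegral_const_mul' _ _ ENNReal.coe_ne_top,
          Manifold.pathELength_eq_lintegral_mfderivWithin_Icc]
    _ ≤ C * Manifold.pathELength 𝓘(ℝ, E) γ 0 1 := by
      gcongr
    _ < C * (r / C) := by
      gcongr
      · exact ENNReal.coe_ne_top
      · exact hγ.trans_eq (ENNReal.coe_div C_pos.ne')
    _ = r := (ENNReal.eq_div_iff (by simpa using C_pos.ne') ENNReal.coe_ne_top).mp rfl
  have : γ' t₁ ∈ φ.symm ⁻¹' v := by
    apply hr
    rw [← Metric.eball_coe, Metric.mem_eball, edist_eq_enorm_sub]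
    convert! hnorm
    simp [γ', hγx]
  convert! mem_preimage.1 this
  simp only [Function.comp_apply, γ', φ.left_inv <| uc <| t₁_mem (right_mem_Icc.mpr ht₁0)]

/-- The points at finite distance from `x` form a set that is open and closed. -/
theorem finslerEDist_ne_top (N : FinslerStructure E X) [ConnectedSpace X] (x y : X) :
    N.finslerEDist x y ≠ ⊤ := by
  have hopen : IsOpen {y | N.finslerEDist x y < ⊤} := isOpen_iff_mem_nhds.2 fun y hy => by
    filter_upwards [N.eventually_finslerEDist_lt y ENNReal.zero_lt_top] with z hz
    exact (N.finslerEDist_triangle x y z).trans_lt (ENNReal.add_lt_top.2 ⟨hy, hz⟩)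
  have hclosed : IsClosed {y | N.finslerEDist x y < ⊤} := by
    refine ⟨isOpen_iff_mem_nhds.2 fun y hy => ?_⟩
    filter_upwards [N.eventually_finslerEDist_lt y ENNReal.zero_lt_top] with z hz hxz
    refine hy ((N.finslerEDist_triangle x z y).trans_lt (ENNReal.add_lt_top.2 ⟨hxz, ?_⟩))
    rwa [N.finslerEDist_comm]
  have huniv := IsClopen.eq_univ ⟨hclosed, hopen⟩ ⟨x, by simp [N.finslerEDist_self]⟩
  exact (huniv ▸ mem_univ y : y ∈ {y | N.finslerEDist x y < ⊤}).ne

/-- The Finsler distance as a pseudo-extended-metric structure; its topology is definitionally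
the given topology of the manifold. -/
@[reducible] noncomputable def pseudoEMetricSpace (N : FinslerStructure E X) [RegularSpace X] :
    PseudoEMetricSpace X :=
  PseudoEMetricSpace.ofEDistOfTopology N.finslerEDist N.finslerEDist_self N.finslerEDist_comm
    N.finslerEDist_triangle fun x => (basis_sets (𝓝 x)).to_hasBasis'
      (fun _ hs => N.exists_finslerEDist_lt_subset hs)
      (fun _ hc => N.eventually_finslerEDist_lt x hc)

/-- The Finsler distance as a metric structure on a connected manifold; its topology is
definitionally the given topology of the manifold. -/
@[reducible] noncomputable def metricSpace (N : FinslerStructure E X) [T3Space X] [ConnectedSpace X] :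
    MetricSpace X :=
  letI := N.pseudoEMetricSpace
  letI : PseudoMetricSpace X := PseudoEMetricSpace.toPseudoMetricSpace N.finslerEDist_ne_top
  MetricSpace.ofT0PseudoMetricSpace X

theorem IsComplete.completeSpace {N : FinslerStructure E X} [T3Space X] [ConnectedSpace X]
    (h : N.IsComplete) :
    letI := N.metricSpace
    CompleteSpace X := by
  let := N.metricSpace
  refine Metric.complete_of_cauchySeq_tendsto fun u hu => ?_
  obtain ⟨x, hx⟩ := h u fun ε hε => Metric.cauchySeq_iff.1 hu ε hε
  exact ⟨x, tendsto_iff_dist_tendsto_zero.2 hx⟩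

end FinslerStructure

/-! ### A descent principle in complete metric spaces -/

/-- A variant of Caristi's theorem with a variable rate of descent. Pairs `(x, l)` of a point and
an upper bound for the length spent to reach it from `x₀` are ordered by
`d(x, x') ≤ l' - l` and `ρ(l') - ρ(l) ≤ g(x) - g(x')`; a maximal pair is a zero of `g`. -/
theorem exists_eq_zero_of_local_descent {M : Type*} [MetricSpace M] [CompleteSpace M]
    {g : M → ℝ} (hg : Continuous g) (hg0 : ∀ x, 0 ≤ g x) {x₀ : M} {r : ℝ} (hr : 0 ≤ r)
    {ρ : ℝ → ℝ} (hρ : ContinuousOn ρ (Icc 0 r)) (hρ0 : ρ 0 = 0) (hgr : g x₀ < ρ r)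
    (step : ∀ x l, 0 ≤ l → l < r → dist x₀ x ≤ l → g x + ρ l ≤ g x₀ → 0 < g x →
      ∃ x' l', l < l' ∧ l' ≤ r ∧ dist x x' ≤ l' - l ∧ ρ l' - ρ l ≤ g x - g x') :
    ∃ x, dist x₀ x < r ∧ g x = 0 := by
  let S : Set (M × ℝ) := {z | z.2 ∈ Icc 0 r ∧ dist x₀ z.1 ≤ z.2 ∧ g z.1 + ρ z.2 ≤ g x₀}
  let R : S → S → Prop := fun a b =>
    dist a.1.1 b.1.1 ≤ b.1.2 - a.1.2 ∧ ρ b.1.2 - ρ a.1.2 ≤ g a.1.1 - g b.1.1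
  have hrefl : ∀ a, R a a := fun a => by simp [R]
  have htrans : ∀ {a b c}, R a b → R b c → R a c := fun {a b c} hab hbc =>
    ⟨by linarith [hab.1, hbc.1, dist_triangle a.1.1 b.1.1 c.1.1], by linarith [hab.2, hbc.2]⟩
  obtain ⟨⟨⟨x, l⟩, ⟨hl0, hlr⟩, hxl, hgl⟩, hmax⟩ : ∃ m, ∀ a, R m a → R a m := by
    refine exists_maximal_of_chains_bounded (fun c hc => ?_) htrans
    -- A chain is Cauchy along a sequence of its elements whose second components tend to their
    -- supremum; the limit is an upper bound.
    rcases c.eq_empty_or_nonempty with rfl | hne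
    · exact ⟨⟨(x₀, 0), ⟨le_rfl, hr⟩, by simp, by simp [hρ0]⟩, by simp⟩
    have htot : ∀ a ∈ c, ∀ b ∈ c, R a b ∨ R b a := fun a ha b hb => by
      by_cases hab : a = b
      · exact Or.inl (hab ▸ hrefl a)
      · exact hc ha hb hab
    have hdist : ∀ a ∈ c, ∀ b ∈ c, dist a.1.1 b.1.1 ≤ dist a.1.2 b.1.2 := fun a ha b hb => by
      rw [Real.dist_eq]
      rcases htot a ha b hb with h | h
      · exact h.1.trans (abs_sub_comm a.1.2 b.1.2 ▸ le_abs_self _)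
      · rw [dist_comm]
        exact h.1.trans (le_abs_self _)
    have hbdd : BddAbove ((fun a : S => a.1.2) '' c) :=
      ⟨r, by rintro _ ⟨a, -, rfl⟩; exact a.2.1.2⟩
    obtain ⟨u, -, hu, huc⟩ := exists_seq_tendsto_sSup (hne.image _) hbdd
    set L := sSup ((fun a : S => a.1.2) '' c)
    choose z hzc hz using huc
    have hcau : CauchySeq fun n => (z n).1.1 := by
      refine Metric.cauchySeq_iff.2 fun ε hε => ?_
      obtain ⟨n₀, h⟩ := Metric.cauchySeq_iff.1 hu.cauchySeq ε hε
      refine ⟨n₀, fun m hm n hn => (hdist _ (hzc m) _ (hzc n)).trans_lt ?_⟩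
      simpa only [hz] using h m hm n hn
    obtain ⟨y, hy⟩ := cauchySeq_tendsto_of_complete hcau
    have hzL : Tendsto (fun n => (z n).1.2) atTop (𝓝 L) := by simpa only [hz] using hu
    have hLmem : L ∈ Icc 0 r := isClosed_Icc.mem_of_tendsto hzL (.of_forall fun n => (z n).2.1)
    have hρL : Tendsto (fun n => ρ (z n).1.2) atTop (𝓝 (ρ L)) :=
      (hρ L hLmem).tendsto.comp
        (tendsto_nhdsWithin_iff.2 ⟨hzL, .of_forall fun n => (z n).2.1⟩)
    have hgy : Tendsto (fun n => g (z n).1.1) atTop (𝓝 (g y)) := (hg.tendsto y).comp hy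
    refine ⟨⟨(y, L), hLmem,
      le_of_tendsto_of_tendsto' (tendsto_const_nhds.dist hy) hzL fun n => (z n).2.2.1,
      le_of_tendsto' (hgy.add hρL) fun n => (z n).2.2.2⟩, fun a ha => ?_⟩
    rcases (le_csSup hbdd (mem_image_of_mem _ ha)).lt_or_eq with hlt | heq
    · have hev : ∀ᶠ n in atTop, R a (z n) := by
        filter_upwards [hzL.eventually (lt_mem_nhds hlt)] with n hn
        refine (htot a ha _ (hzc n)).resolve_right fun h => ?_
        linarith [h.1, dist_nonneg (x := (z n).1.1) (y := a.1.1)]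
      exact ⟨le_of_tendsto_of_tendsto (tendsto_const_nhds.dist hy) (hzL.sub_const _)
          (hev.mono fun n hn => hn.1),
        le_of_tendsto_of_tendsto (hρL.sub_const _) (tendsto_const_nhds.sub hgy)
          (hev.mono fun n hn => hn.2)⟩
    · -- The supremum is attained at `a`, so that the limit point is `a` itself.
      have h0 : Tendsto (fun n => dist a.1.1 (z n).1.1) atTop (𝓝 0) := by
        refine squeeze_zero (fun _ => dist_nonneg) (fun n => hdist a ha _ (hzc n)) ?_
        have h := (tendsto_const_nhds (x := L)).dist hzL
        rwa [dist_self, ← show a.1.2 = L from heq] at h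
      have hay : a.1.1 = y :=
        dist_eq_zero.1 (tendsto_nhds_unique (tendsto_const_nhds.dist hy) h0)
      have haL : a.1.2 = L := heq
      simp [R, hay, haL]
  have hlt : l < r := by
    refine lt_of_le_of_ne hlr ?_
    rintro rfl
    have := hg0 x
    simp only at hgl
    linarith
  refine ⟨x, hxl.trans_lt hlt, ?_⟩
  by_contra hne
  obtain ⟨x', l', hll', hl'r, hd, hρ'⟩ :=
    step x l hl0 hlt hxl hgl ((hg0 x).lt_of_ne (Ne.symm hne))
  have hd' := dist_triangle x₀ x x'
  have h := hmax ⟨(x', l'), ⟨hl0.trans hll'.le, hl'r⟩, by simp only at hxl ⊢; linarith,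
    by simp only at hgl ⊢; linarith⟩ ⟨hd, hρ'⟩
  have h1 := h.1
  simp only at h1
  linarith [dist_nonneg (x := x') (y := x)]

/-! ### Primitives of antitone functions -/

section Antitone

variable {η : ℝ → ℝ}

theorem AntitoneOn.intervalIntegrable_of_nonneg (hη : AntitoneOn η (Ici 0)) {a b : ℝ}
    (ha : 0 ≤ a) (hb : 0 ≤ b) : IntervalIntegrable η MeasureTheory.volume a b :=
  (hη.mono fun _ hx => (le_min ha hb).trans hx.1).intervalIntegrable

theorem AntitoneOn.integral_sub_integral_le (hη : AntitoneOn η (Ici 0)) {a b : ℝ}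
    (ha : 0 ≤ a) (hab : a ≤ b) :
    (∫ t in (0 : ℝ)..b, η t) - ∫ t in (0 : ℝ)..a, η t ≤ η a * (b - a) := by
  have hb := ha.trans hab
  rw [intervalIntegral.integral_interval_sub_left
    (hη.intervalIntegrable_of_nonneg le_rfl hb) (hη.intervalIntegrable_of_nonneg le_rfl ha)]
  calc ∫ t in a..b, η t ≤ ∫ _ in a..b, η a :=
        intervalIntegral.integral_mono_on hab (hη.intervalIntegrable_of_nonneg ha hb)
          intervalIntegrable_const fun t ht => hη ha (ha.trans ht.1) ht.1
    _ = η a * (b - a) := by simp [mul_comm]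

theorem AntitoneOn.continuousOn_integral (hη : AntitoneOn η (Ici 0)) {r : ℝ} (hr : 0 ≤ r) :
    ContinuousOn (fun a => ∫ t in (0 : ℝ)..a, η t) (Icc 0 r) := by
  have := intervalIntegral.continuousOn_primitive_interval'
    (hη.intervalIntegrable_of_nonneg le_rfl hr) (left_mem_uIcc (a := (0 : ℝ)) (b := r))
  rwa [uIcc_of_le hr] at this

end Antitone

/-! ### The surjectivity indicator and the operator norm -/

section Indicators

variable {E : Type*} [NormedAddCommGroup E] [NormedSpace ℝ E]
  {X : Type*} [TopologicalSpace X] [ChartedSpace E X] [IsManifold 𝓘(ℝ, E) 2 X]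
  {F : Type*} [NormedAddCommGroup F] [NormedSpace ℝ F]

namespace FinslerStructure

theorem dualNorm_nonneg (N : FinslerStructure E X) (x : X)
    (l : TangentSpace 𝓘(ℝ, E) x →L[ℝ] ℝ) : 0 ≤ N.dualNorm x l := by
  refine Real.sSup_nonneg ?_
  rintro _ ⟨v, -, rfl⟩
  exact abs_nonneg _

theorem dualNorm_le (N : FinslerStructure E X) {x : X} {l : TangentSpace 𝓘(ℝ, E) x →L[ℝ] ℝ}
    {A : ℝ} (h : ∀ v, N.nrm x v ≤ 1 → |l v| ≤ A) : N.dualNorm x l ≤ A := by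
  refine csSup_le ⟨0, 0, by simp, by simp⟩ ?_
  rintro _ ⟨v, hv, rfl⟩
  exact h v hv

theorem opNorm_nonneg (N : FinslerStructure E X) (x : X)
    (T : F →L[ℝ] TangentSpace 𝓘(ℝ, E) x) : 0 ≤ N.opNorm x T := by
  refine Real.sSup_nonneg ?_
  rintro _ ⟨y, -, rfl⟩
  exact apply_nonneg _ _

theorem opNorm_le (N : FinslerStructure E X) {x : X} {T : F →L[ℝ] TangentSpace 𝓘(ℝ, E) x}
    {A : ℝ} (h : ∀ y, ‖y‖ ≤ 1 → N.nrm x (T y) ≤ A) : N.opNorm x T ≤ A := by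
  refine csSup_le ⟨0, 0, by simp, by simp⟩ ?_
  rintro _ ⟨y, hy, rfl⟩
  exact h y hy

theorem exists_nrm_le_norm (N : FinslerStructure E X) (x : X)
    (T : F →L[ℝ] TangentSpace 𝓘(ℝ, E) x) : ∃ C : ℝ, ∀ y, N.nrm x (T y) ≤ C * ‖y‖ := by
  obtain ⟨φ, hφ, hx, C, hC, hb⟩ := N.exists_chart_norm_equiv x
  obtain ⟨p, hp, rfl⟩ : ∃ p ∈ φ.target, φ.symm p = x := ⟨φ x, φ.map_source hx, φ.left_inv hx⟩
  let L : F →L[ℝ] E := ContinuousLinearMap.comp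
    (mfderiv 𝓘(ℝ, E) 𝓘(ℝ, E) φ (φ.symm p) : TangentSpace 𝓘(ℝ, E) (φ.symm p) →L[ℝ] E) T
  refine ⟨C * ‖L‖, fun y => ?_⟩
  have h := (hb p hp (L y)).2
  have hL : chartVec φ p (L y) = T y := chartVec_mfderiv hφ hp (T y)
  rw [hL] at h
  calc N.nrm (φ.symm p) (T y) ≤ C * ‖L y‖ := h
    _ ≤ C * (‖L‖ * ‖y‖) := by gcongr; exact L.le_opNorm y
    _ = _ := by ring

theorem nrm_le_opNorm_mul (N : FinslerStructure E X) (x : X)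
    (T : F →L[ℝ] TangentSpace 𝓘(ℝ, E) x) (y : F) : N.nrm x (T y) ≤ N.opNorm x T * ‖y‖ := by
  rcases eq_or_ne y 0 with rfl | hy
  · simp
  have hy' : 0 < ‖y‖ := norm_pos_iff.2 hy
  obtain ⟨C, hC⟩ := N.exists_nrm_le_norm x T
  have hbdd : BddAbove {a : ℝ | ∃ y : F, ‖y‖ ≤ 1 ∧ a = N.nrm x (T y)} := by
    refine ⟨|C|, ?_⟩
    rintro _ ⟨z, hz, rfl⟩
    calc N.nrm x (T z) ≤ C * ‖z‖ := hC z
      _ ≤ |C| * 1 := by gcongr; exact le_abs_self C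
      _ = _ := mul_one _
  have h : N.nrm x (T (‖y‖⁻¹ • y)) ≤ N.opNorm x T :=
    le_csSup hbdd ⟨_, by rw [norm_smul, norm_inv, norm_norm, inv_mul_cancel₀ hy'.ne'], rfl⟩
  rwa [map_smul, map_smul_eq_mul, norm_inv, norm_norm, inv_mul_le_iff₀ hy', mul_comm] at h

end FinslerStructure

theorem surInd_nonneg (N : FinslerStructure E X) (f : X → F) (x : X) : 0 ≤ surInd N f x := by
  refine Real.sInf_nonneg ?_
  rintro _ ⟨l, -, rfl⟩
  exact N.dualNorm_nonneg x _

/-- Every linear form bounds the surjectivity indicator from above, normalized or not. -/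
theorem surInd_mul_norm_le (N : FinslerStructure E X) (f : X → F) (x : X) {A : ℝ} (l : F →L[ℝ] ℝ)
    (hA : 0 ≤ A) (h : ∀ v, N.nrm x v ≤ 1 → |l (dAt (E := E) f x v)| ≤ A) :
    surInd N f x * ‖l‖ ≤ A := by
  rcases eq_or_ne l 0 with rfl | hl
  · simpa using hA
  have hl' : 0 < ‖l‖ := norm_pos_iff.2 hl
  rw [← le_div_iff₀ hl']
  have hbdd : BddBelow {a : ℝ | ∃ l : F →L[ℝ] ℝ, ‖l‖ = 1 ∧
      a = N.dualNorm x (l.comp (dAt (E := E) f x))} := by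
    refine ⟨0, ?_⟩
    rintro _ ⟨l, -, rfl⟩
    exact N.dualNorm_nonneg x _
  refine (csInf_le hbdd ⟨‖l‖⁻¹ • l, ?_, rfl⟩).trans (N.dualNorm_le fun v hv => ?_)
  · rw [norm_smul, norm_inv, norm_norm, inv_mul_cancel₀ hl'.ne']
  · rw [div_eq_inv_mul]
    change |‖l‖⁻¹ * l (dAt (E := E) f x v)| ≤ _
    rw [abs_mul, abs_of_nonneg (inv_nonneg.2 hl'.le)]
    gcongr
    exact h v hv

section Eta

variable {N : FinslerStructure E X} {f : X → F} {c : ℝ}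

theorem bddBelow_surInd (N : FinslerStructure E X) (f : X → F) (x₀ : X) (ρ : ℝ) :
    BddBelow {a : ℝ | ∃ x : X, N.finslerDist x₀ x ≤ ρ ∧ a = surInd N f x} := by
  refine ⟨0, ?_⟩
  rintro _ ⟨x, -, rfl⟩
  exact surInd_nonneg N f x

theorem antitoneOn_etaFun (hc : 0 < c) (x₀ : X) : AntitoneOn (etaFun N f c x₀) (Ici 0) := by
  intro a ha b _ hab
  refine mul_le_mul_of_nonneg_left (csInf_le_csInf (bddBelow_surInd N f x₀ b) ?_ ?_) (by positivity)
  · exact ⟨_, x₀, by simpa [FinslerStructure.finslerDist, N.finslerEDist_self] using ha, rfl⟩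
  · rintro _ ⟨x, hx, rfl⟩
    exact ⟨x, hx.trans hab, rfl⟩

theorem mul_etaFun_le_surInd (hc : 0 < c) {x₀ x : X} {ρ : ℝ} (hx : N.finslerDist x₀ x ≤ ρ) :
    c * etaFun N f c x₀ ρ ≤ surInd N f x := by
  rw [etaFun, ← mul_assoc, mul_one_div_cancel hc.ne', one_mul]
  exact csInf_le (bddBelow_surInd N f x₀ ρ) ⟨x, hx, rfl⟩

theorem etaFun_nonneg (hc : 0 < c) (x₀ : X) (ρ : ℝ) : 0 ≤ etaFun N f c x₀ ρ := by
  refine mul_nonneg (by positivity) (Real.sInf_nonneg ?_)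
  rintro _ ⟨x, -, rfl⟩
  exact surInd_nonneg N f x

end Eta

end Indicators

/-! ### The covering property -/

section Covering

variable {E : Type*} [NormedAddCommGroup E] [NormedSpace ℝ E]
  {X : Type*} [TopologicalSpace X] [ChartedSpace E X]
  {F : Type*} [NormedAddCommGroup F] [NormedSpace ℝ F]

/-- The derivative of `f` read in a chart represents `df` in that chart. -/
theorem differentiableAt_comp_symm_and_fderiv_eq {f : X → F}
    (hf : ContMDiff 𝓘(ℝ, E) 𝓘(ℝ, F) 1 f) {φ : OpenPartialHomeomorph X E}
    (hφ : φ ∈ IsManifold.maximalAtlas 𝓘(ℝ, E) 2 X) {p : E} (hp : p ∈ φ.target) :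
    DifferentiableAt ℝ (fun q => f (φ.symm q)) p ∧
      ∀ w, fderiv ℝ (fun q => f (φ.symm q)) p w = dAt f (φ.symm p) (chartVec φ p w) := by
  have h1 : MDifferentiableAt 𝓘(ℝ, E) 𝓘(ℝ, F) f (φ.symm p) :=
    (hf.mdifferentiable one_ne_zero) _
  have h2 := (mdifferentiable_of_mem_maximalAtlas hφ).mdifferentiableAt_symm hp
  let L : E →L[ℝ] F := ContinuousLinearMap.comp (dAt (E := E) f (φ.symm p))
    (mfderiv 𝓘(ℝ, E) 𝓘(ℝ, E) φ.symm p : E →L[ℝ] TangentSpace 𝓘(ℝ, E) (φ.symm p))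
  have h3 : HasFDerivAt (fun q => f (φ.symm q)) L p :=
    (h1.hasMFDerivAt.comp p h2.hasMFDerivAt).hasFDerivAt
  refine ⟨h3.differentiableAt, fun w => ?_⟩
  rw [h3.fderiv]
  rfl

variable [IsManifold 𝓘(ℝ, E) 2 X]

/-- Moving from `x` along a tangent vector `v` with `df(x) v = y - f x` decreases the distance of
the values of `f` to `y` at a rate as close to `‖f x - y‖` as desired. -/
theorem FinslerStructure.eventually_exists_descent (N : FinslerStructure E X) {f : X → F}
    (hf : ContMDiff 𝓘(ℝ, E) 𝓘(ℝ, F) 1 f) {x : X} {y : F} {v : TangentSpace 𝓘(ℝ, E) x}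
    (hv : dAt f x v = y - f x) {A : ℝ} (hA : N.nrm x v ≤ A) (hy : 0 < ‖f x - y‖) {ε : ℝ}
    (hε : 0 < ε) :
    ∀ᶠ t in 𝓝[>] (0 : ℝ), ∃ x', N.finslerDist x x' ≤ (1 + ε) * (t * A) ∧
      ‖f x' - y‖ ≤ ‖f x - y‖ - (1 - ε) * (t * ‖f x - y‖) := by
  have hA0 : 0 ≤ A := (apply_nonneg _ _).trans hA
  obtain ⟨φ, hφ, hx, hk⟩ := N.almost_constant x (1 + ε) (by linarith)
  obtain ⟨p, hp, rfl⟩ : ∃ p ∈ φ.target, φ.symm p = x := ⟨φ x, φ.map_source hx, φ.left_inv hx⟩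
  rw [φ.right_inv hp] at hk
  let w : E := mfderiv 𝓘(ℝ, E) 𝓘(ℝ, E) φ (φ.symm p) v
  have hw : chartVec φ p w = v := chartVec_mfderiv hφ hp v
  obtain ⟨δ, hδ, hball⟩ := Metric.isOpen_iff.1 φ.open_target p hp
  have hcurve : HasDerivAt (fun t : ℝ => p + t • w) w 0 := by
    simpa using ((hasDerivAt_id (0 : ℝ)).smul_const w).const_add p
  have hder : HasDerivAt (fun t : ℝ => f (φ.symm (p + t • w))) (y - f (φ.symm p)) 0 := by
    obtain ⟨h1, h2⟩ := differentiableAt_comp_symm_and_fderiv_eq hf hφ hp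
    rw [← hv, ← hw, ← h2]
    exact h1.hasFDerivAt.comp_hasDerivAt_of_eq (0 : ℝ) hcurve (by simp)
  have hsmall : ∀ᶠ t in 𝓝 (0 : ℝ), p + t • w ∈ Metric.ball p δ :=
    hcurve.continuousAt.preimage_mem_nhds (by simpa using Metric.ball_mem_nhds p hδ)
  have hlin := (hasDerivAt_iff_isLittleO.1 hder).def (mul_pos hε hy)
  filter_upwards [hsmall.filter_mono nhdsWithin_le_nhds, hlin.filter_mono nhdsWithin_le_nhds,
    self_mem_nhdsWithin, nhdsWithin_le_nhds (Iio_mem_nhds one_pos)] with t ht hlt ht0 ht1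
  simp only [mem_Ioi, mem_Iio] at ht0 ht1
  refine ⟨φ.symm (p + t • w), ?_, ?_⟩
  · have hseg := ((convex_ball p δ).segment_subset (Metric.mem_ball_self hδ) ht).trans hball
    refine ENNReal.toReal_le_of_le_ofReal (by positivity)
      (N.finslerEDist_symm_le hφ hseg fun z hz => ((hk z (hseg hz) _).2.trans ?_))
    have : chartVec φ p (p + t • w - p) = t • v := by
      rw [add_sub_cancel_left, ← hw]
      exact map_smul (mfderiv 𝓘(ℝ, E) 𝓘(ℝ, E) φ.symm p) t w
    rw [this, map_smul_eq_mul, Real.norm_of_nonneg ht0.le]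
    gcongr
  · simp only [zero_smul, add_zero, sub_zero, Real.norm_of_nonneg ht0.le] at hlt
    set a := f (φ.symm p)
    set b := f (φ.symm (p + t • w))
    have hb : b - y = (b - a - t • (y - a)) + (1 - t) • (a - y) := by module
    calc ‖b - y‖ ≤ ‖b - a - t • (y - a)‖ + ‖(1 - t) • (a - y)‖ := by
          rw [hb]; exact norm_add_le _ _
      _ ≤ ε * ‖a - y‖ * t + (1 - t) * ‖a - y‖ := by
          rw [norm_smul, Real.norm_of_nonneg (by linarith)]
          gcongr
      _ = _ := by ring

/-- The covering property: the descent principle applied to `x ↦ ‖f x - y‖`. -/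
theorem ball_subset_image_of_isRabierPair [T3Space X] [ConnectedSpace X]
    {N : FinslerStructure E X} (hX : N.IsComplete) {f : X → F}
    (hf : ContMDiff 𝓘(ℝ, E) 𝓘(ℝ, F) 1 f) {c : ℝ}
    {s : (x : X) → F →L[ℝ] TangentSpace 𝓘(ℝ, E) x} (hs : IsRabierPair N f c s) (x₀ : X) {r : ℝ}
    (hr : 0 < r) :
    Metric.ball (f x₀) (rhoFun N f c x₀ r) ⊆ f '' {x : X | N.finslerDist x₀ x < r} := by
  intro y hy
  obtain ⟨hc, ⟨-, hinv⟩, hsur⟩ := hs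
  let := N.metricSpace
  have := hX.completeSpace
  have hanti := antitoneOn_etaFun (N := N) (f := f) hc x₀
  have hyr : ‖f x₀ - y‖ < rhoFun N f c x₀ r := by
    rwa [Metric.mem_ball, dist_comm, dist_eq_norm] at hy
  -- The factor `1 - 2 ε` absorbs the errors of the linearization and of the chart.
  obtain ⟨ε, hε, hε1, hεr⟩ : ∃ ε : ℝ, 0 < ε ∧ 2 * ε < 1 ∧
      ‖f x₀ - y‖ < (1 - 2 * ε) * rhoFun N f c x₀ r := by
    have h1 : ∀ᶠ ε in 𝓝[>] (0 : ℝ), ‖f x₀ - y‖ < (1 - 2 * ε) * rhoFun N f c x₀ r := by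
      have : Tendsto (fun ε : ℝ => (1 - 2 * ε) * rhoFun N f c x₀ r) (𝓝[>] 0)
          (𝓝 ((1 - 2 * 0) * rhoFun N f c x₀ r)) :=
        Tendsto.mono_left (Continuous.tendsto (by fun_prop) 0) nhdsWithin_le_nhds
      refine this.eventually (lt_mem_nhds ?_)
      simpa using hyr
    have h2 : ∀ᶠ ε in 𝓝[>] (0 : ℝ), 2 * ε < 1 := by
      filter_upwards [nhdsWithin_le_nhds (Iio_mem_nhds (show (0 : ℝ) < 1 / 2 by norm_num))]
        with ε hε
      rw [mem_Iio] at hε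
      linarith
    obtain ⟨ε, h, h', h''⟩ := (h1.and (h2.and self_mem_nhdsWithin)).exists
    exact ⟨ε, h'', h', h⟩
  have step : ∀ x l, 0 ≤ l → l < r → N.finslerDist x₀ x ≤ l →
      ‖f x - y‖ + (1 - 2 * ε) * rhoFun N f c x₀ l ≤ ‖f x₀ - y‖ → 0 < ‖f x - y‖ →
      ∃ x' l', l < l' ∧ l' ≤ r ∧ N.finslerDist x x' ≤ l' - l ∧
        (1 - 2 * ε) * rhoFun N f c x₀ l' - (1 - 2 * ε) * rhoFun N f c x₀ l
          ≤ ‖f x - y‖ - ‖f x' - y‖ := by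
    intro x l hl0 hlr hxl hgl hgx
    set e := etaFun N f c x₀ l with he
    -- Otherwise `ϱ` would be constant on `[l, r]`, although `(1 - 2 ε) ϱ(l) ≤ ‖f x₀ - y‖`.
    have he0 : 0 < e := by
      refine (etaFun_nonneg hc x₀ l).lt_of_ne' fun h0 => ?_
      have h := hanti.integral_sub_integral_le hl0 hlr.le
      rw [h0, zero_mul] at h
      have h' : rhoFun N f c x₀ r ≤ rhoFun N f c x₀ l := by rw [rhoFun, rhoFun]; linarith
      have := mul_le_mul_of_nonneg_left h' (show 0 ≤ 1 - 2 * ε by linarith)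
      linarith [norm_nonneg (f x - y)]
    have hop : N.opNorm x (s x) ≤ e⁻¹ := by
      have h1 : c * e ≤ c * (N.opNorm x (s x))⁻¹ :=
        (mul_etaFun_le_surInd hc hxl).trans (hsur x)
      have h2 : e ≤ (N.opNorm x (s x))⁻¹ := le_of_mul_le_mul_left h1 hc
      exact le_inv_of_le_inv₀ he0 h2
    have hA : N.nrm x (s x (y - f x)) ≤ e⁻¹ * ‖f x - y‖ := by
      rw [norm_sub_rev]
      exact (N.nrm_le_opNorm_mul x (s x) _).trans (by gcongr)
    have hlim : Tendsto (fun t : ℝ => l + (1 + ε) * (t * (e⁻¹ * ‖f x - y‖))) (𝓝[>] 0) (𝓝 l) := by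
      refine Tendsto.mono_left ?_ nhdsWithin_le_nhds
      have : Continuous fun t : ℝ => l + (1 + ε) * (t * (e⁻¹ * ‖f x - y‖)) := by fun_prop
      simpa using this.tendsto 0
    obtain ⟨t, ⟨x', hd, hg⟩, htr, ht0⟩ :=
      ((N.eventually_exists_descent hf (hinv x (y - f x)) hA hgx hε).and
        ((hlim.eventually (gt_mem_nhds hlr)).and self_mem_nhdsWithin)).exists
    -- The distance charged to the step is the bound `(1 + ε) t ‖f x - y‖ / η(l)`.
    refine ⟨x', _, ?_, htr.le, ?_, ?_⟩
    · have : 0 < (1 + ε) * (t * (e⁻¹ * ‖f x - y‖)) := by positivity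
      linarith
    · rw [add_sub_cancel_left]
      exact hd
    · have hpos : 0 ≤ (1 + ε) * (t * (e⁻¹ * ‖f x - y‖)) := by positivity
      have h := hanti.integral_sub_integral_le hl0 (le_add_of_nonneg_right (a := l) hpos)
      rw [add_sub_cancel_left, ← he] at h
      have h2 : e * ((1 + ε) * (t * (e⁻¹ * ‖f x - y‖))) = (1 + ε) * (t * ‖f x - y‖) := by
        field_simp
      rw [h2] at h
      have h3 := mul_le_mul_of_nonneg_left h (show 0 ≤ 1 - 2 * ε by linarith)
      have h4 : (1 - 2 * ε) * ((1 + ε) * (t * ‖f x - y‖)) ≤ (1 - ε) * (t * ‖f x - y‖) := by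
        rw [← mul_assoc]
        gcongr
        nlinarith
      simp only [rhoFun]
      linarith
  obtain ⟨x, hx, hfx⟩ := exists_eq_zero_of_local_descent (g := fun x => ‖f x - y‖)
    (hf.continuous.sub continuous_const).norm (fun _ => norm_nonneg _) hr.le
    (ρ := fun l => (1 - 2 * ε) * rhoFun N f c x₀ l)
    ((hanti.continuousOn_integral hr.le).const_mul _) (by simp [rhoFun]) hεr step
  exact ⟨x, hx, sub_eq_zero.1 (norm_eq_zero.1 hfx)⟩

end Covering

/-! ### Right inverses and linear forms -/

section Linear

variable {E : Type*} [NormedAddCommGroup E] [NormedSpace ℝ E]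
  {F : Type*} [NormedAddCommGroup F] [NormedSpace ℝ F]

/-- A projection with the kernel of a surjective continuous linear map `A` factors through `A`;
the factor is a continuous right inverse of `A`. -/
theorem ContinuousLinearMap.exists_rightInverse_of_projection [CompleteSpace E] [CompleteSpace F]
    {A : E →L[ℝ] F} (hA : Function.Surjective A) {P : E →L[ℝ] E} (hP : ∀ v, P (P v) = P v)
    (hker : ∀ v, P v = 0 ↔ A v = 0) :
    ∃ T : F →L[ℝ] E, (∀ y, A (T y) = y) ∧ ∀ v, T (A v) = P v := by
  obtain ⟨C, hC, hpre⟩ := A.exists_preimage_norm_le hA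
  choose g hg hgn using hpre
  have hfac : ∀ {v w}, A v = A w → P v = P w := fun {v w} h => by
    rw [← sub_eq_zero, ← map_sub, hker, map_sub, h, sub_self]
  have hAP : ∀ v, A (P v) = A v := fun v => by
    rw [← sub_eq_zero, ← map_sub, ← hker, map_sub, hP, sub_self]
  let T₀ : F →ₗ[ℝ] E :=
    { toFun := fun y => P (g y)
      map_add' := fun y z => by
        rw [← map_add]
        exact hfac (by simp only [map_add, hg])
      map_smul' := fun a y => by
        rw [RingHom.id_apply, ← map_smul]
        exact hfac (by simp only [map_smul, hg]) }
  refine ⟨T₀.mkContinuous (‖P‖ * C) fun y => ?_, fun y => ?_, fun v => ?_⟩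
  · calc ‖P (g y)‖ ≤ ‖P‖ * ‖g y‖ := P.le_opNorm _
      _ ≤ ‖P‖ * (C * ‖y‖) := by gcongr; exact hgn y
      _ = _ := by ring
  · change A (P (g y)) = y
    rw [hAP, hg]
  · exact hfac (hg _)

/-- Hahn–Banach for a seminorm dominated by the norm. -/
theorem Seminorm.exists_dual_eq (m : Seminorm ℝ F) {M : ℝ} (hm : ∀ y, m y ≤ M * ‖y‖) (y : F) :
    ∃ l : F →L[ℝ] ℝ, l y = m y ∧ ∀ z, |l z| ≤ m z := by
  rcases eq_or_ne y 0 with rfl | hy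
  · exact ⟨0, by simp, by simp⟩
  obtain ⟨l, hl, hle⟩ := exists_extension_of_le_sublinear (LinearPMap.mkSpanSingleton y (m y) hy) m
    (fun c hc x => by rw [map_smul_eq_mul, Real.norm_of_nonneg hc.le]) (map_add_le_add m) (by
      rintro ⟨x, hx⟩
      obtain ⟨a, rfl⟩ := Submodule.mem_span_singleton.1 hx
      refine (LinearPMap.mkSpanSingleton'_apply y (m y) _ a hx).trans_le ?_
      rw [map_smul_eq_mul, smul_eq_mul]
      gcongr
      exact le_abs_self a)
  have habs : ∀ z, |l z| ≤ m z := fun z => abs_le.2 ⟨by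
    have := hle (-z)
    rw [map_neg, map_neg_eq_map] at this
    linarith, hle z⟩
  refine ⟨l.mkContinuous M fun z => (habs z).trans (hm z), ?_, habs⟩
  have := hl ⟨y, Submodule.mem_span_singleton_self y⟩
  rw [LinearMap.mkContinuous_apply, this]
  exact LinearPMap.mkSpanSingleton_apply ℝ ℝ hy (m y)

end Linear

/-! ### Functions that are Lipschitz near a point -/

section LocLip

/-- `g` is Lipschitz on some neighborhood of `q`. -/
def LocLipAt {α β : Type*} [PseudoEMetricSpace α] [PseudoEMetricSpace β] (g : α → β) (q : α) :
    Prop :=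
  ∃ K, ∃ t ∈ 𝓝 q, LipschitzOnWith K g t

section Metric

variable {α β γ : Type*} [PseudoEMetricSpace α] [PseudoEMetricSpace β] [PseudoEMetricSpace γ]

theorem locallyLipschitzOn_iff_locLipAt {s : Set α} (hs : IsOpen s) {g : α → β} :
    LocallyLipschitzOn s g ↔ ∀ q ∈ s, LocLipAt g q := by
  refine forall₂_congr fun q hq => ?_
  rw [hs.nhdsWithin_eq hq, LocLipAt]

namespace LocLipAt

variable {g h : α → β} {q : α}

theorem continuousAt (hg : LocLipAt g q) : ContinuousAt g q := by
  obtain ⟨K, t, ht, hL⟩ := hg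
  exact hL.continuousOn.continuousAt ht

theorem congr (hg : LocLipAt g q) (h' : h =ᶠ[𝓝 q] g) : LocLipAt h q := by
  obtain ⟨K, t, ht, hL⟩ := hg
  refine ⟨K, _, inter_mem ht h', fun x hx y hy => ?_⟩
  rw [show h x = g x from hx.2, show h y = g y from hy.2]
  exact hL hx.1 hy.1

theorem prodMk {g' : α → γ} (hg : LocLipAt g q) (hg' : LocLipAt g' q) :
    LocLipAt (fun x => (g x, g' x)) q := by
  obtain ⟨K, t, ht, hL⟩ := hg
  obtain ⟨K', t', ht', hL'⟩ := hg'
  exact ⟨_, _, inter_mem ht ht',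
    (hL.mono inter_subset_left).prodMk (hL'.mono inter_subset_right)⟩

theorem comp {G : β → γ} (hG : LocLipAt G (g q)) (hg : LocLipAt g q) :
    LocLipAt (fun x => G (g x)) q := by
  have hc := hg.continuousAt
  obtain ⟨K, t, ht, hL⟩ := hG
  obtain ⟨K', t', ht', hL'⟩ := hg
  exact ⟨_, _, inter_mem (hc.preimage_mem_nhds ht) ht',
    (hL.comp (hL'.mono inter_subset_right) fun x hx => hx.1)⟩

end LocLipAt

end Metric

namespace LocLipAt

variable {E : Type*} [NormedAddCommGroup E] [NormedSpace ℝ E]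
  {V : Type*} [NormedAddCommGroup V] [NormedSpace ℝ V]
  {W : Type*} [NormedAddCommGroup W] [NormedSpace ℝ W]
  {α : Type*} [PseudoEMetricSpace α] {g : α → V} {q : α}

theorem _root_.ContDiffAt.locLipAt {g : E → V} {q : E} (hg : ContDiffAt ℝ 1 g q) : LocLipAt g q :=
  hg.exists_lipschitzOnWith

theorem smul {a : α → ℝ} (ha : LocLipAt a q) (hg : LocLipAt g q) :
    LocLipAt (fun x => a x • g x) q :=
  LocLipAt.comp (G := fun z : ℝ × V => z.1 • z.2)
    (contDiff_fst.smul contDiff_snd).contDiffAt.locLipAt (ha.prodMk hg)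

theorem clm_comp {U : Type*} [NormedAddCommGroup U] [NormedSpace ℝ U] {A : α → V →L[ℝ] W}
    {B : α → U →L[ℝ] V} (hA : LocLipAt A q) (hB : LocLipAt B q) :
    LocLipAt (fun x => (A x).comp (B x)) q := by
  have h : ContDiff ℝ 1 fun z : (V →L[ℝ] W) × (U →L[ℝ] V) => z.1.comp z.2 :=
    isBoundedBilinearMap_comp.contDiff
  exact LocLipAt.comp (g := fun x => (A x, B x)) h.contDiffAt.locLipAt (hA.prodMk hB)

theorem sum {ι : Type*} {I : Finset ι} {g : ι → α → V} (hg : ∀ i ∈ I, LocLipAt (g i) q) :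
    LocLipAt (fun x => ∑ i ∈ I, g i x) q := by
  classical
  induction I using Finset.induction_on with
  | empty => exact ⟨0, univ, univ_mem, (LipschitzWith.const (0 : V)).lipschitzOnWith⟩
  | insert i I hi ih =>
    simp only [Finset.sum_insert hi]
    exact LocLipAt.comp (G := fun z : V × V => z.1 + z.2)
      (contDiff_fst.add contDiff_snd).contDiffAt.locLipAt
      ((hg i (Finset.mem_insert_self i I)).prodMk
        (ih fun j hj => hg j (Finset.mem_insert_of_mem hj)))

theorem inv {a : α → ℝ} (ha : LocLipAt a q) (h0 : a q ≠ 0) : LocLipAt (fun x => (a x)⁻¹) q :=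
  LocLipAt.comp (contDiffAt_inv ℝ h0).locLipAt ha

theorem ringInverse [CompleteSpace V] {B : α → V →L[ℝ] V} (hB : LocLipAt B q)
    (h1 : IsUnit (B q)) : LocLipAt (fun x => Ring.inverse (B x)) q := by
  obtain ⟨u, hu⟩ := h1
  exact LocLipAt.comp (hu ▸ (contDiffAt_ringInverse ℝ u).locLipAt) hB

end LocLipAt

end LocLip

/-! ### Local right inverses with controlled norm -/

section LocalSection

variable {E : Type*} [NormedAddCommGroup E] [NormedSpace ℝ E] [CompleteSpace E]
  {X : Type*} [TopologicalSpace X] [ChartedSpace E X] [IsManifold 𝓘(ℝ, E) 2 X]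
  {F : Type*} [NormedAddCommGroup F] [NormedSpace ℝ F] [CompleteSpace F]

/-- Near `x₀`, and read in a suitable chart, the family `S(p) = T ∘ (A(p) ∘ T)⁻¹` is a right
inverse of the derivative `A(p)` of `f`, where `T` is the right inverse of `A(p₀)` coming from the
projection `P`. If `m(y)` denotes the Finsler norm of `T y`, then every linear form `l` dominated
by `m` satisfies `|l (df(x₀) v)| ≤ m (df(x₀) v) = ‖P v‖ ≤ C ‖v‖`; taking `l` with `l y = m y`
relates `‖T‖` to `Sur df`. -/
theorem exists_local_rightInverse (N : FinslerStructure E X) {f : X → F}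
    (hsub : IsSubmersionMap E f) (hlip : HasLocallyLipschitzDeriv E f) {C : ℝ} (hC : 0 < C)
    (x₀ : X) {P : TangentSpace 𝓘(ℝ, E) x₀ →L[ℝ] TangentSpace 𝓘(ℝ, E) x₀}
    (hP : ∀ v, P (P v) = P v) (hker : ∀ v, P v = 0 ↔ dAt (E := E) f x₀ v = 0)
    (hPC : ∀ v, N.nrm x₀ (P v) ≤ C * N.nrm x₀ v) :
    ∃ φ ∈ IsManifold.maximalAtlas 𝓘(ℝ, E) 2 X, ∃ p₀ ∈ φ.target, φ.symm p₀ = x₀ ∧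
      ∃ S : E → F →L[ℝ] E, ∀ᶠ p in 𝓝 p₀, LocLipAt S p ∧
        (∀ y, dAt (E := E) f (φ.symm p) (chartVec φ p (S p y)) = y) ∧
        ∀ y, surInd N f (φ.symm p) * N.nrm (φ.symm p) (chartVec φ p (S p y))
          ≤ (16 * C + 8) * ‖y‖ := by
  obtain ⟨hf, hfl⟩ := hlip
  obtain ⟨φ, hφ, hx, hk⟩ := N.almost_constant x₀ 2 one_lt_two
  obtain ⟨p₀, hp₀, rfl⟩ : ∃ p ∈ φ.target, φ.symm p = x₀ := ⟨φ x₀, φ.map_source hx, φ.left_inv hx⟩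
  rw [φ.right_inv hp₀] at hk
  obtain ⟨C₀, hC₀, hadm⟩ := N.admissible φ hφ p₀ hp₀
  refine ⟨φ, hφ, p₀, hp₀, rfl, ?_⟩
  let D : E →L[ℝ] TangentSpace 𝓘(ℝ, E) (φ.symm p₀) := mfderiv 𝓘(ℝ, E) 𝓘(ℝ, E) φ.symm p₀
  let D' : TangentSpace 𝓘(ℝ, E) (φ.symm p₀) →L[ℝ] E := mfderiv 𝓘(ℝ, E) 𝓘(ℝ, E) φ (φ.symm p₀)
  have hDD' : ∀ v, D (D' v) = v := chartVec_mfderiv hφ hp₀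
  let A : E → E →L[ℝ] F := fun p => fderiv ℝ (fun q => f (φ.symm q)) p
  have hA : ∀ p ∈ φ.target, ∀ w, A p w = dAt (E := E) f (φ.symm p) (chartVec φ p w) :=
    fun p hp w => (differentiableAt_comp_symm_and_fderiv_eq hf hφ hp).2 w
  have hAlip : ∀ p ∈ φ.target, LocLipAt A p :=
    (locallyLipschitzOn_iff_locLipAt φ.open_target).1 (hfl φ hφ)
  obtain ⟨T, hAT, hTA⟩ := ContinuousLinearMap.exists_rightInverse_of_projection
    (A := A p₀) (P := D'.comp (P.comp D))
    (fun y => by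
      obtain ⟨v, hv⟩ := hsub (φ.symm p₀) y
      refine ⟨D' v, ?_⟩
      rw [hA p₀ hp₀, ← hv]
      exact congrArg _ (hDD' v))
    (fun w => by
      simp only [ContinuousLinearMap.comp_apply]
      rw [hDD', hP])
    (fun w => by
      simp only [ContinuousLinearMap.comp_apply]
      rw [hA p₀ hp₀]
      refine Iff.trans ⟨fun h => ?_, fun h => ?_⟩ (hker (D w))
      · rw [← hDD' (P (D w)), h, map_zero]
      · rw [h, map_zero])
  let Tx : F →L[ℝ] TangentSpace 𝓘(ℝ, E) (φ.symm p₀) := D.comp T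
  let m : Seminorm ℝ F := (N.nrm (φ.symm p₀)).comp Tx.toLinearMap
  set M := N.opNorm (φ.symm p₀) Tx
  have hM0 : 0 ≤ M := N.opNorm_nonneg _ _
  have hm : ∀ y, m y ≤ M * ‖y‖ := N.nrm_le_opNorm_mul _ Tx
  have hmA : ∀ w, m (A p₀ w) ≤ C * N.nrm (φ.symm p₀) (chartVec φ p₀ w) := fun w => by
    have h1 : m (A p₀ w) = N.nrm (φ.symm p₀) (P (D w)) := by
      change N.nrm (φ.symm p₀) (D (T (A p₀ w))) = _
      rw [hTA w]
      simp only [ContinuousLinearMap.comp_apply]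
      rw [hDD']
    rw [h1]
    exact hPC (D w)
  have htarget := φ.open_target.mem_nhds hp₀
  -- The indicator `Sur df` is locally bounded in terms of the norm `M` of `T`.
  have hSur : ∀ᶠ p in 𝓝 p₀, surInd N f (φ.symm p) * M ≤ 4 * C + 2 := by
    rcases hM0.eq_or_lt with h0 | hMpos
    · refine .of_forall fun p => ?_
      rw [← h0, mul_zero]
      positivity
    -- A linear form that is almost norming for `T` has norm at least `M / 2`.
    obtain ⟨_, ⟨y, hy1, rfl⟩, hyM⟩ := exists_lt_of_lt_csSup
      (s := {a : ℝ | ∃ y : F, ‖y‖ ≤ 1 ∧ a = N.nrm (φ.symm p₀) (Tx y)})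
      ⟨0, 0, by simp, by simp⟩ (half_lt_self hMpos)
    obtain ⟨l, hly, hl⟩ := m.exists_dual_eq hm y
    have hlM : M / 2 ≤ ‖l‖ := calc
      M / 2 ≤ m y := hyM.le
      _ ≤ ‖l y‖ := hly ▸ le_abs_self _
      _ ≤ ‖l‖ * ‖y‖ := l.le_opNorm y
      _ ≤ ‖l‖ * 1 := by gcongr
      _ = ‖l‖ := mul_one _
    have hlim : ∀ᶠ p in 𝓝 p₀, ‖l‖ * (‖A p - A p₀‖ * (C₀ * 2)) < 1 := by
      have : ContinuousAt (fun p => ‖l‖ * (‖A p - A p₀‖ * (C₀ * 2))) p₀ :=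
        ((((hAlip p₀ hp₀).continuousAt.sub continuousAt_const).norm).mul_const _).const_mul _
      refine this.eventually_lt continuousAt_const ?_
      simp
    filter_upwards [hlim, htarget] with p hlp hp
    have h1 : surInd N f (φ.symm p) * ‖l‖ ≤ 2 * C + 1 := by
      refine surInd_mul_norm_le N f _ l (by positivity) fun v hv => ?_
      obtain ⟨w, rfl⟩ : ∃ w, chartVec φ p w = v := ⟨_, chartVec_mfderiv hφ hp v⟩
      have hw : N.nrm (φ.symm p₀) (chartVec φ p₀ w) ≤ 2 := by
        have := (hk p hp w).1
        linarith
      have hw' : ‖w‖ ≤ C₀ * 2 := by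
        have := (hadm w).1
        rw [inv_mul_le_iff₀ hC₀] at this
        exact this.trans (by gcongr)
      rw [← hA p hp]
      have hsplit : l (A p w) = l (A p₀ w) + l ((A p - A p₀) w) := by
        rw [← map_add, sub_apply, add_sub_cancel]
      calc |l (A p w)| ≤ |l (A p₀ w)| + |l ((A p - A p₀) w)| := by
            rw [hsplit]
            exact abs_add_le _ _
        _ ≤ C * 2 + ‖l‖ * (‖A p - A p₀‖ * (C₀ * 2)) := by
            gcongr
            · exact (hl _).trans ((hmA w).trans (by gcongr))
            · refine (l.le_opNorm _).trans ?_
              gcongr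
              exact ((A p - A p₀).le_opNorm w).trans (by gcongr)
        _ ≤ 2 * C + 1 := by linarith
    have h2 := mul_le_mul_of_nonneg_left hlM (surInd_nonneg N f (φ.symm p))
    linarith
  have hB : ∀ p ∈ φ.target, LocLipAt (fun p => (A p).comp T) p := fun p hp =>
    (hAlip p hp).clm_comp ⟨0, univ, univ_mem, (LipschitzWith.const T).lipschitzOnWith⟩
  have hB₀ : (A p₀).comp T = 1 := ContinuousLinearMap.ext hAT
  have hunit : ∀ᶠ p in 𝓝 p₀, IsUnit ((A p).comp T) :=
    (hB p₀ hp₀).continuousAt.preimage_mem_nhds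
      (Units.isOpen.mem_nhds (show IsUnit ((A p₀).comp T) by rw [hB₀]; exact isUnit_one))
  have hinv : ∀ᶠ p in 𝓝 p₀, ‖Ring.inverse ((A p).comp T)‖ < 2 := by
    have h1 : LocLipAt (fun p => Ring.inverse ((A p).comp T)) p₀ :=
      (hB p₀ hp₀).ringInverse (by rw [hB₀]; exact isUnit_one)
    refine h1.continuousAt.norm.eventually_lt continuousAt_const ?_
    rw [hB₀, Ring.inverse_one]
    exact ContinuousLinearMap.norm_id_le.trans_lt one_lt_two
  refine ⟨fun p => T.comp (Ring.inverse ((A p).comp T)), ?_⟩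
  filter_upwards [htarget, hSur, hunit, hinv] with p hp hSp hup hip
  refine ⟨LocLipAt.clm_comp ⟨0, univ, univ_mem, (LipschitzWith.const T).lipschitzOnWith⟩
    ((hB p hp).ringInverse hup), fun y => ?_, fun y => ?_⟩
  · rw [← hA p hp]
    exact congr($(Ring.mul_inverse_cancel _ hup) y)
  · set z := Ring.inverse ((A p).comp T) y with hz
    have hzy : ‖z‖ ≤ 2 * ‖y‖ := (ContinuousLinearMap.le_opNorm _ y).trans (by gcongr)
    have h1 : N.nrm (φ.symm p) (chartVec φ p (T z)) ≤ M * (4 * ‖y‖) := calc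
      _ ≤ 2 * m z := (hk p hp (T z)).2
      _ ≤ 2 * (M * (2 * ‖y‖)) := by
        gcongr
        exact (hm z).trans (by gcongr)
      _ = _ := by ring
    calc surInd N f (φ.symm p) * N.nrm (φ.symm p) (chartVec φ p (T z))
        ≤ surInd N f (φ.symm p) * (M * (4 * ‖y‖)) :=
          mul_le_mul_of_nonneg_left h1 (surInd_nonneg N f _)
      _ = surInd N f (φ.symm p) * M * (4 * ‖y‖) := by ring
      _ ≤ (4 * C + 2) * (4 * ‖y‖) := by gcongr
      _ = _ := by ring

end LocalSection

/-! ### Locally Lipschitz families of linear maps into the tangent spaces -/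

section Sections

variable {E : Type*} [NormedAddCommGroup E] [NormedSpace ℝ E]
  {X : Type*} [TopologicalSpace X] [ChartedSpace E X]
  {F : Type*} [NormedAddCommGroup F] [NormedSpace ℝ F]
  {φ ψ : OpenPartialHomeomorph X E}

theorem contDiffAt_transition (hφ : φ ∈ IsManifold.maximalAtlas 𝓘(ℝ, E) 2 X)
    (hψ : ψ ∈ IsManifold.maximalAtlas 𝓘(ℝ, E) 2 X) {x : X} (hxφ : x ∈ φ.source)
    (hxψ : x ∈ ψ.source) : ContDiffAt ℝ 2 (fun q => φ (ψ.symm q)) (ψ x) := by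
  have h1 : ContMDiffAt 𝓘(ℝ, E) 𝓘(ℝ, E) 2 φ (ψ.symm (ψ x)) :=
    contMDiffAt_of_mem_maximalAtlas hφ (by rwa [ψ.left_inv hxψ])
  have h2 : ContMDiffAt 𝓘(ℝ, E) 𝓘(ℝ, E) 2 ψ.symm (ψ x) :=
    contMDiffAt_symm_of_mem_maximalAtlas hψ (ψ.map_source hxψ)
  exact (h1.comp (ψ x) h2).contDiffAt

theorem fderiv_transition_mfderiv (hφ : φ ∈ IsManifold.maximalAtlas 𝓘(ℝ, E) 2 X)
    (hψ : ψ ∈ IsManifold.maximalAtlas 𝓘(ℝ, E) 2 X) {x : X} (hxφ : x ∈ φ.source)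
    (hxψ : x ∈ ψ.source) (v : TangentSpace 𝓘(ℝ, E) x) :
    fderiv ℝ (fun p => ψ (φ.symm p)) (φ x) (mfderiv 𝓘(ℝ, E) 𝓘(ℝ, E) φ x v)
      = mfderiv 𝓘(ℝ, E) 𝓘(ℝ, E) ψ x v := by
  have h1 : MDifferentiableAt 𝓘(ℝ, E) 𝓘(ℝ, E) (fun p => ψ (φ.symm p)) (φ x) :=
    mdifferentiableAt_iff_differentiableAt.2
      ((contDiffAt_transition hψ hφ hxψ hxφ).differentiableAt two_ne_zero)
  have h2 := (mdifferentiable_of_mem_maximalAtlas hφ).mdifferentiableAt hxφ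
  have h3 : (fun z => ψ (φ.symm (φ z))) =ᶠ[𝓝 x] ψ := by
    filter_upwards [φ.open_source.mem_nhds hxφ] with z hz
    rw [φ.left_inv hz]
  have h4 := mfderiv_comp x h1 h2
  rw [mfderiv_eq_fderiv] at h4
  have h5 : mfderiv 𝓘(ℝ, E) 𝓘(ℝ, E) ((fun p => ψ (φ.symm p)) ∘ φ) x v
      = mfderiv 𝓘(ℝ, E) 𝓘(ℝ, E) ψ x v := by
    have : mfderiv 𝓘(ℝ, E) 𝓘(ℝ, E) ((fun p => ψ (φ.symm p)) ∘ φ) x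
      = mfderiv 𝓘(ℝ, E) 𝓘(ℝ, E) ψ x := h3.mfderiv_eq
    rw [this]
    rfl
  rw [← h5, h4]
  rfl

theorem chartRep_apply_of_mem_source (s : (x : X) → F →L[ℝ] TangentSpace 𝓘(ℝ, E) x) {x : X}
    (hx : x ∈ φ.source) (y : F) :
    chartRep s φ (φ x) y = mfderiv 𝓘(ℝ, E) 𝓘(ℝ, E) φ x (s x y) := by
  obtain ⟨p, hp, rfl⟩ : ∃ p ∈ φ.target, φ.symm p = x := ⟨φ x, φ.map_source hx, φ.left_inv hx⟩
  rw [φ.right_inv hp]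
  rfl

/-- Local Lipschitz continuity at a point of a function on `X` read in a chart does not depend on
the chart. -/
theorem LocLipAt.change_chart {V : Type*} [NormedAddCommGroup V] [NormedSpace ℝ V] {g : X → V}
    (hφ : φ ∈ IsManifold.maximalAtlas 𝓘(ℝ, E) 2 X) (hψ : ψ ∈ IsManifold.maximalAtlas 𝓘(ℝ, E) 2 X)
    {x : X} (hxφ : x ∈ φ.source) (hxψ : x ∈ ψ.source)
    (h : LocLipAt (fun p => g (φ.symm p)) (φ x)) : LocLipAt (fun q => g (ψ.symm q)) (ψ x) := by
  have h1 := ((contDiffAt_transition hφ hψ hxφ hxψ).of_le one_le_two).locLipAt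
  have h2 : LocLipAt (fun q => g (φ.symm (φ (ψ.symm q)))) (ψ x) :=
    LocLipAt.comp (G := fun p => g (φ.symm p)) (by rwa [ψ.left_inv hxψ]) h1
  refine h2.congr ?_
  have hev : ∀ᶠ q in 𝓝 (ψ x), ψ.symm q ∈ φ.source :=
    (ψ.continuousAt_symm (ψ.map_source hxψ)).preimage_mem_nhds
      (φ.open_source.mem_nhds (by rwa [ψ.left_inv hxψ]))
  filter_upwards [hev] with q hq
  rw [φ.left_inv hq]

/-- The family `s` of linear maps into the tangent spaces is Lipschitz near `x` in every chart
around `x`. -/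
def SectionLocLipAt (s : (x : X) → F →L[ℝ] TangentSpace 𝓘(ℝ, E) x) (x : X) : Prop :=
  ∀ ψ ∈ IsManifold.maximalAtlas 𝓘(ℝ, E) 2 X, x ∈ ψ.source → LocLipAt (chartRep s ψ) (ψ x)

/-- It suffices to verify local Lipschitz continuity in one chart, because the derivative of a
`C²` change of charts is locally Lipschitz. -/
theorem sectionLocLipAt_of_chart {s : (x : X) → F →L[ℝ] TangentSpace 𝓘(ℝ, E) x} {x : X}
    (hφ : φ ∈ IsManifold.maximalAtlas 𝓘(ℝ, E) 2 X) (hx : x ∈ φ.source)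
    (h : LocLipAt (chartRep s φ) (φ x)) : SectionLocLipAt s x := by
  intro ψ hψ hxψ
  have hτ := ((contDiffAt_transition hφ hψ hx hxψ).of_le one_le_two).locLipAt
  have hD : LocLipAt (fderiv ℝ fun p => ψ (φ.symm p)) (φ (ψ.symm (ψ x))) := by
    rw [ψ.left_inv hxψ]
    exact ((contDiffAt_transition hψ hφ hxψ hx).fderiv_right (m := 1)
      (by norm_num)).locLipAt
  have h' : LocLipAt (chartRep s φ) (φ (ψ.symm (ψ x))) := by rwa [ψ.left_inv hxψ]
  refine ((LocLipAt.comp (g := fun q => φ (ψ.symm q)) hD hτ).clm_comp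
    (LocLipAt.comp (g := fun q => φ (ψ.symm q)) h' hτ)).congr ?_
  have hev : ∀ᶠ q in 𝓝 (ψ x), ψ.symm q ∈ φ.source :=
    (ψ.continuousAt_symm (ψ.map_source hxψ)).preimage_mem_nhds
      (φ.open_source.mem_nhds (by rwa [ψ.left_inv hxψ]))
  filter_upwards [hev, ψ.open_target.mem_nhds (ψ.map_source hxψ)] with q hq hqt
  ext y
  rw [ContinuousLinearMap.comp_apply, chartRep_apply_of_mem_source s hq]
  exact (fderiv_transition_mfderiv hφ hψ hq (ψ.map_target hqt) _).symm

variable [IsManifold 𝓘(ℝ, E) 2 X]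

/-- Functions that are `1`-Lipschitz for the Finsler distance are locally Lipschitz in charts. -/
theorem FinslerStructure.locLipAt_of_edist_le (N : FinslerStructure E X) {g : X → ℝ}
    (hg : ∀ x y, edist (g x) (g y) ≤ N.finslerEDist x y) {x : X}
    (hψ : ψ ∈ IsManifold.maximalAtlas 𝓘(ℝ, E) 2 X) (hx : x ∈ ψ.source) :
    LocLipAt (fun q => g (ψ.symm q)) (ψ x) := by
  obtain ⟨φ, hφ, hxφ, C, hC, δ, hδ, -, h⟩ := N.exists_chart_finslerEDist_le x
  refine LocLipAt.change_chart hφ hψ hxφ hx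
    ⟨C.toNNReal, _, Metric.ball_mem_nhds _ hδ, fun p hp q hq => ?_⟩
  refine (hg _ _).trans ((h p hp q hq).trans_eq ?_)
  rw [ENNReal.ofReal_mul hC.le, ofReal_norm, edist_comm, edist_eq_enorm_sub]
  rfl

open Metric in
/-- For every open set `U` there is a `1`-Lipschitz function that is positive exactly on `U`:
the distance to the complement, truncated at `1`. The truncation also covers the case that the
complement is empty. -/
theorem FinslerStructure.exists_bump (N : FinslerStructure E X) [RegularSpace X] {U : Set X}
    (hU : IsOpen U) : ∃ g : X → ℝ, (∀ x, 0 ≤ g x) ∧ (∀ x, g x ≠ 0 ↔ x ∈ U) ∧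
      ∀ x y, edist (g x) (g y) ≤ N.finslerEDist x y := by
  let := N.pseudoEMetricSpace
  have hle : ∀ x, min 1 (infEDist x Uᶜ) ≠ ⊤ := fun x => (min_lt_of_left_lt ENNReal.one_lt_top).ne
  refine ⟨fun x => (min 1 (infEDist x Uᶜ)).toReal, fun x => ENNReal.toReal_nonneg, fun x => ?_,
    fun x y => ?_⟩
  · rw [Ne, ENNReal.toReal_eq_zero_iff, not_or, and_iff_left (hle x), ← Ne, ← pos_iff_ne_zero,
      lt_min_iff, and_iff_right one_pos, infEDist_pos_iff_notMem_closure,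
      hU.isClosed_compl.closure_eq, notMem_compl_iff]
  · have key : ∀ x y, min 1 (infEDist x Uᶜ) ≤ min 1 (infEDist y Uᶜ) + edist x y := fun x y => by
      rw [min_add]
      exact min_le_min le_self_add infEDist_le_infEDist_add_edist
    change _ ≤ edist x y
    by_cases htop : edist x y = ⊤
    · rw [htop]
      exact le_top
    have key' : ∀ x y, edist x y ≠ ⊤ → (min 1 (infEDist x Uᶜ)).toReal
        ≤ (min 1 (infEDist y Uᶜ)).toReal + (edist x y).toReal := fun x y h => by
      rw [← ENNReal.toReal_add (hle y) h]
      exact ENNReal.toReal_mono (ENNReal.add_ne_top.2 ⟨hle y, h⟩) (key x y)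
    rw [edist_dist, Real.dist_eq]
    refine ENNReal.ofReal_le_of_le_toReal (abs_sub_le_iff.2 ⟨?_, ?_⟩)
    · linarith [key' x y htop]
    · rw [edist_comm x y] at htop ⊢
      linarith [key' y x htop]

/-- Local solutions of a convex condition are glued to a global one by a locally Lipschitz
partition of unity. -/
theorem FinslerStructure.exists_section_of_local (N : FinslerStructure E X) [T2Space X]
    [ParacompactSpace X] {t : (x : X) → Set (F →L[ℝ] TangentSpace 𝓘(ℝ, E) x)}
    (ht : ∀ x, Convex ℝ (t x))
    (h : ∀ x₀, ∃ s : (x : X) → F →L[ℝ] TangentSpace 𝓘(ℝ, E) x,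
      ∀ᶠ x in 𝓝 x₀, SectionLocLipAt s x ∧ s x ∈ t x) :
    ∃ s : (x : X) → F →L[ℝ] TangentSpace 𝓘(ℝ, E) x, ∀ x, SectionLocLipAt s x ∧ s x ∈ t x := by
  choose σ hσ using h
  choose Z hZ hZc hZσ using fun x₀ => exists_mem_nhds_isClosed_subset (hσ x₀)
  obtain ⟨U, hUo, hUc, hUf, hUZ⟩ := precise_refinement (fun x₀ => interior (Z x₀))
    (fun _ => isOpen_interior)
    (eq_univ_of_forall fun x => mem_iUnion.2 ⟨x, mem_interior_iff_mem_nhds.2 (hZ x)⟩)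
  have hUσ : ∀ i, closure (U i) ⊆ {x | SectionLocLipAt (σ i) x ∧ σ i x ∈ t x} := fun i =>
    (closure_minimal ((hUZ i).trans interior_subset) (hZc i)).trans (hZσ i)
  choose θ hθ0 hθU hθL using fun i => N.exists_bump (hUo i)
  -- Near every point only the indices of a finite set contribute.
  have hfin : ∀ x, ∃ n ∈ 𝓝 x, ∃ I : Finset X, ∀ z ∈ n, ∀ i, θ i z ≠ 0 → i ∈ I := fun x => by
    obtain ⟨n, hn, hI⟩ := hUf x
    exact ⟨n, hn, hI.toFinset, fun z hz i hi => hI.mem_toFinset.2 ⟨z, (hθU i z).1 hi, hz⟩⟩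
  let Θ : X → ℝ := fun x => ∑ᶠ i, θ i x
  have hsum : ∀ {z : X} {I : Finset X}, (∀ i, θ i z ≠ 0 → i ∈ I) → Θ z = ∑ i ∈ I, θ i z :=
    fun hI => finsum_eq_sum_of_support_subset _ hI
  have hΘ : ∀ x, Θ x ≠ 0 := fun x => by
    obtain ⟨n, hn, I, hI⟩ := hfin x
    obtain ⟨i, hi⟩ := mem_iUnion.1 (hUc.symm ▸ mem_univ x : x ∈ ⋃ i, U i)
    have hi' := (hθU i x).2 hi
    have hI' := hI x (mem_of_mem_nhds hn)
    rw [hsum hI']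
    exact (Finset.sum_pos' (fun j _ => hθ0 j x)
      ⟨i, hI' i hi', (hθ0 i x).lt_of_ne hi'.symm⟩).ne'
  have hΘ0 : ∀ x, 0 ≤ Θ x := fun x => finsum_nonneg fun i => hθ0 i x
  refine ⟨fun x => ∑ᶠ i, ((Θ x)⁻¹ * θ i x) • σ i x, fun x => ⟨fun ψ hψ hx => ?_, ?_⟩⟩
  · obtain ⟨n, hn, I, hI⟩ := hfin x
    have hterm : ∀ i ∈ I, LocLipAt (fun q => θ i (ψ.symm q) • chartRep (σ i) ψ q) (ψ x) := by
      intro i _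
      by_cases hxi : x ∈ closure (U i)
      · exact (N.locLipAt_of_edist_le (hθL i) hψ hx).smul ((hUσ i hxi).1 ψ hψ hx)
      · -- Here `σ i` is not controlled, but the weight vanishes near `x`.
        refine LocLipAt.congr (g := fun _ => 0)
          ⟨0, univ, univ_mem, (LipschitzWith.const _).lipschitzOnWith⟩ ?_
        have hev : ∀ᶠ q in 𝓝 (ψ x), ψ.symm q ∈ (closure (U i))ᶜ :=
          (ψ.continuousAt_symm (ψ.map_source hx)).preimage_mem_nhds
            (isClosed_closure.isOpen_compl.mem_nhds (by rwa [ψ.left_inv hx]))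
        filter_upwards [hev] with q hq
        have : θ i (ψ.symm q) = 0 := by
          by_contra h0
          exact hq (subset_closure ((hθU i _).1 h0))
        rw [this, zero_smul]
    have hIx : ∀ i, θ i x ≠ 0 → i ∈ I := hI x (mem_of_mem_nhds hn)
    have hden : LocLipAt (fun q => (∑ i ∈ I, θ i (ψ.symm q))⁻¹) (ψ x) := by
      refine (LocLipAt.sum fun i _ => N.locLipAt_of_edist_le (hθL i) hψ hx).inv ?_
      rw [ψ.left_inv hx, ← hsum hIx]
      exact hΘ x
    refine (hden.smul (LocLipAt.sum hterm)).congr ?_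
    have hev : ∀ᶠ q in 𝓝 (ψ x), ψ.symm q ∈ n :=
      (ψ.continuousAt_symm (ψ.map_source hx)).preimage_mem_nhds (by rwa [ψ.left_inv hx])
    filter_upwards [hev] with q hq
    have hIq := hI _ hq
    ext y
    have h1 : (∑ᶠ i, ((Θ (ψ.symm q))⁻¹ * θ i (ψ.symm q)) • σ i (ψ.symm q))
        = ∑ i ∈ I, ((Θ (ψ.symm q))⁻¹ * θ i (ψ.symm q)) • σ i (ψ.symm q) := by
      refine finsum_eq_sum_of_support_subset _ fun i hi => hIq i fun h0 => hi ?_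
      simp only [h0, mul_zero, zero_smul]
    let Λ : (F →L[ℝ] TangentSpace 𝓘(ℝ, E) (ψ.symm q)) →ₗ[ℝ] E :=
      { toFun := fun T => mfderiv 𝓘(ℝ, E) 𝓘(ℝ, E) ψ (ψ.symm q) (T y)
        map_add' := fun T T' => map_add (mfderiv 𝓘(ℝ, E) 𝓘(ℝ, E) ψ (ψ.symm q)) (T y) (T' y)
        map_smul' := fun a T => map_smul (mfderiv 𝓘(ℝ, E) 𝓘(ℝ, E) ψ (ψ.symm q)) a (T y) }
    change Λ (∑ᶠ i, ((Θ (ψ.symm q))⁻¹ * θ i (ψ.symm q)) • σ i (ψ.symm q)) = _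
    rw [h1, map_sum, ← hsum hIq, smul_apply, sum_apply, Finset.smul_sum]
    refine Finset.sum_congr rfl fun i _ => ?_
    rw [map_smul, mul_smul]
    rfl
  · refine (ht x).finsum_mem (fun i => mul_nonneg (inv_nonneg.2 (hΘ0 x)) (hθ0 i x)) ?_
      fun i hi => (hUσ i (subset_closure ((hθU i x).1 (right_ne_zero_of_mul hi)))).2
    obtain ⟨n, hn, I, hI⟩ := hfin x
    have hI' := hI x (mem_of_mem_nhds hn)
    rw [finsum_eq_sum_of_support_subset (s := I) _
      fun i hi => hI' i (right_ne_zero_of_mul hi), ← Finset.mul_sum, ← hsum hI',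
      inv_mul_cancel₀ (hΘ x)]

end Sections

/-! ### Existence of a controlled right inverse -/

section Existence

variable {E : Type*} [NormedAddCommGroup E] [NormedSpace ℝ E] [CompleteSpace E]
  {X : Type*} [TopologicalSpace X] [ChartedSpace E X] [IsManifold 𝓘(ℝ, E) 2 X]
  [T2Space X] [ParacompactSpace X]
  {F : Type*} [NormedAddCommGroup F] [NormedSpace ℝ F] [CompleteSpace F]

theorem exists_isRabierPair (N : FinslerStructure E X) {f : X → F} (hsub : IsSubmersionMap E f)
    (hsplit : HasUniformlySplitKernels N f) (hlip : HasLocallyLipschitzDeriv E f) :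
    ∃ (c : ℝ) (s : (x : X) → F →L[ℝ] TangentSpace 𝓘(ℝ, E) x), IsRabierPair N f c s := by
  obtain ⟨C, hC, hP⟩ := hsplit
  let t : (x : X) → Set (F →L[ℝ] TangentSpace 𝓘(ℝ, E) x) := fun x =>
    {T | (∀ y, dAt (E := E) f x (T y) = y) ∧
      ∀ y, surInd N f x * N.nrm x (T y) ≤ (16 * C + 8) * ‖y‖}
  have ht : ∀ x, Convex ℝ (t x) := by
    intro x T hT T' hT' a b ha hb hab
    refine ⟨fun y => ?_, fun y => ?_⟩
    · change dAt (E := E) f x (a • T y + b • T' y) = y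
      rw [map_add, map_smul, map_smul, hT.1, hT'.1, ← add_smul, hab, one_smul]
    · calc surInd N f x * N.nrm x (a • T y + b • T' y)
          ≤ surInd N f x * (a * N.nrm x (T y) + b * N.nrm x (T' y)) := by
            refine mul_le_mul_of_nonneg_left ((map_add_le_add _ _ _).trans_eq ?_)
              (surInd_nonneg N f x)
            rw [map_smul_eq_mul, map_smul_eq_mul, Real.norm_of_nonneg ha, Real.norm_of_nonneg hb]
        _ = a * (surInd N f x * N.nrm x (T y)) + b * (surInd N f x * N.nrm x (T' y)) := by ring
        _ ≤ a * ((16 * C + 8) * ‖y‖) + b * ((16 * C + 8) * ‖y‖) :=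
            add_le_add (mul_le_mul_of_nonneg_left (hT.2 y) ha)
              (mul_le_mul_of_nonneg_left (hT'.2 y) hb)
        _ = (16 * C + 8) * ‖y‖ := by rw [← add_mul, hab, one_mul]
  obtain ⟨s, hs⟩ := N.exists_section_of_local ht fun x₀ => by
    obtain ⟨P, hPP, hker, hPC⟩ := hP x₀
    obtain ⟨φ, hφ, p₀, hp₀, rfl, S, hS⟩ :=
      exists_local_rightInverse N hsub hlip hC x₀ hPP hker hPC
    let s : (x : X) → F →L[ℝ] TangentSpace 𝓘(ℝ, E) x := fun x =>
      ContinuousLinearMap.comp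
        (mfderiv 𝓘(ℝ, E) 𝓘(ℝ, E) φ.symm (φ x) : E →L[ℝ] TangentSpace 𝓘(ℝ, E) x) (S (φ x))
    have hsS : ∀ p ∈ φ.target, ∀ y, s (φ.symm p) y = chartVec φ p (S p y) := fun p hp y => by
      have key : ∀ a, a = p → @Eq E (mfderiv 𝓘(ℝ, E) 𝓘(ℝ, E) φ.symm a (S a y))
          (chartVec φ p (S p y)) := by
        rintro _ rfl
        rfl
      exact key _ (φ.right_inv hp)
    have hrep : ∀ p ∈ φ.target, chartRep s φ p = S p := fun p hp => by
      ext y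
      change mfderiv 𝓘(ℝ, E) 𝓘(ℝ, E) φ (φ.symm p) (s (φ.symm p) y) = S p y
      rw [hsS p hp, mfderiv_chartVec hφ hp]
    have hx₀ := φ.map_target hp₀
    have hcont : ∀ᶠ x in 𝓝 (φ.symm p₀), LocLipAt S (φ x) ∧
        (∀ y, dAt (E := E) f (φ.symm (φ x)) (chartVec φ (φ x) (S (φ x) y)) = y) ∧
        ∀ y, surInd N f (φ.symm (φ x)) * N.nrm (φ.symm (φ x)) (chartVec φ (φ x) (S (φ x) y))
          ≤ (16 * C + 8) * ‖y‖ :=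
      (φ.continuousAt hx₀).eventually (by rwa [φ.right_inv hp₀])
    refine ⟨s, ?_⟩
    filter_upwards [hcont, φ.open_source.mem_nhds hx₀] with x hx hxs
    obtain ⟨p, hp, rfl⟩ : ∃ p ∈ φ.target, φ.symm p = x := ⟨φ x, φ.map_source hxs, φ.left_inv hxs⟩
    rw [φ.right_inv hp] at hx
    refine ⟨sectionLocLipAt_of_chart hφ hxs ?_, fun y => ?_, fun y => ?_⟩
    · rw [φ.right_inv hp]
      refine hx.1.congr ?_
      filter_upwards [φ.open_target.mem_nhds hp] with q hq using hrep q hq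
    · rw [hsS p hp]
      exact hx.2.1 y
    · rw [hsS p hp]
      exact hx.2.2 y
  refine ⟨16 * C + 8, s, by positivity, ⟨fun φ hφ => ?_, fun x => (hs x).2.1⟩, fun x => ?_⟩
  · refine (locallyLipschitzOn_iff_locLipAt φ.open_target).2 fun q hq => ?_
    have := (hs (φ.symm q)).1 φ hφ (φ.map_target hq)
    rwa [φ.right_inv hq] at this
  rcases (N.opNorm_nonneg x (s x)).eq_or_lt with h0 | hpos
  · -- The right inverse vanishes only if `F = 0`, and then `Sur df x` is the infimum of `∅`.
    have hF : ∀ y : F, y = 0 := fun y => by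
      have h1 := N.nrm_le_opNorm_mul x (s x) y
      rw [← h0, zero_mul] at h1
      have h2 : s x y = 0 := N.eq_zero_of_nrm_eq_zero (le_antisymm h1 (apply_nonneg _ _))
      rw [← (hs x).2.1 y, h2, map_zero]
    have hempty : {a : ℝ | ∃ l : F →L[ℝ] ℝ, ‖l‖ = 1 ∧
        a = N.dualNorm x (l.comp (dAt (E := E) f x))} = ∅ := by
      refine eq_empty_of_forall_notMem ?_
      rintro _ ⟨l, hl, -⟩
      have : l = 0 := by
        ext y
        rw [hF y, map_zero, map_zero]
      rw [this, norm_zero] at hl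
      exact zero_ne_one hl
    rw [← h0, surInd, hempty, Real.sInf_empty, inv_zero, mul_zero]
  · rw [← div_eq_mul_inv, le_div_iff₀ hpos]
    rcases (surInd_nonneg N f x).eq_or_lt with hz | hz
    · rw [← hz, zero_mul]
      positivity
    rw [mul_comm, ← le_div_iff₀ hz]
    refine N.opNorm_le fun y hy => ?_
    rw [le_div_iff₀ hz, mul_comm]
    exact ((hs x).2.2 y).trans (mul_le_of_le_one_right (by positivity) hy)

end Existence

theorem mainTheorem1
    {E : Type*} [NormedAddCommGroup E] [NormedSpace ℝ E] [CompleteSpace E]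
    {X : Type*} [TopologicalSpace X] [ChartedSpace E X] [IsManifold 𝓘(ℝ, E) 2 X]
    [T2Space X] [ParacompactSpace X] [ConnectedSpace X]
    {F : Type*} [NormedAddCommGroup F] [NormedSpace ℝ F] [CompleteSpace F]
    (N : FinslerStructure E X) (hX : N.IsComplete)
    (f : X → F) (hsub : IsSubmersionMap E f) (hsplit : HasUniformlySplitKernels N f)
    (hlip : HasLocallyLipschitzDeriv E f) :
    (∃ (c : ℝ) (s : (x : X) → F →L[ℝ] TangentSpace 𝓘(ℝ, E) x), IsRabierPair N f c s) ∧
    ∀ (c : ℝ) (s : (x : X) → F →L[ℝ] TangentSpace 𝓘(ℝ, E) x), IsRabierPair N f c s →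
      ∀ (x₀ : X) (r : ℝ), 0 < r → 0 < rhoFun N f c x₀ r →
        Metric.ball (f x₀) (rhoFun N f c x₀ r) ⊆ f '' {x : X | N.finslerDist x₀ x < r} := by
  refine ⟨exists_isRabierPair N hsub hsplit hlip, fun c s hs x₀ r hr _ => ?_⟩
  exact ball_subset_image_of_isRabierPair hX hlip.1 hs x₀ hr
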